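/- Let $p$ be a prime number, $\mathbb{F}$ a field of characteristic $0$ and $K$ a finite group (not necessarily a $p$-group). For a finite group $G$ let $\mathbb{F}B(G)=\mathbb{F}\otimes_{\mathbb{Z}}B(G)$, where $B(G)$ is the Grothendieck group of finite $G$-sets, and let $\mathbb{F}B_K^{(p)}$ be the Green biset functor on finite $p$-groups obtained by shifting the Burnside functor by $K$: its value at a finite $p$-group $G$ is $\mathbb{F}B(G\times K)$; a finite $(H,G)$-biset $U$ acts by $[X]\mapsto[(U\times K)\times_{G\times K}X]$, where $K$ acts on $U\times K$ on both sides by multiplication on the second component; and the product $\mathbb{F}B(G\times K)\times\mathbb{F}B(H\times K)\to\mathbb{F}B(G\times H\times K)$ is the bilinear map sending $([X],[Y])$ to $[X\times Y]$, with $(g,h,k)\cdot(x,y)=((g,k)x,(h,k)y)$. An ideal $I$ of $\mathbb{F}B_K^{(p)}$ is a family of subspaces $I(G)\subseteq\mathbb{F}B(G\times K)$, one for each finite $p$-group $G$, that is stable under the action of all finite bisets between finite $p$-groups and under products with arbitrary elements of $\mathbb{F}B_K^{(p)}$. The ideals, ordered by inclusion ($I\subseteq J$ if $I(G)\subseteq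 J(G)$ for all $G$), form a lattice $\mathcal{I}_{\mathbb{F}B_K^{(p)}}$. For a finite group $H$ let $O^p(H)$ be the subgroup generated by the elements of order prime to $p$, and $H^{[p]}=H/O^p(H)$. Let $c_K$ (resp. $nc_K$) be the number of conjugacy classes of subgroups $H$ of $K$ such that $H^{[p]}$ is cyclic, possibly trivial (resp. not cyclic). Then the lattice $\mathcal{I}_{\mathbb{F}B_K^{(p)}}$ is isomorphic to the direct product of $c_K$ copies of the totally ordered lattice $\{0,1,2\}$ and $nc_K$ copies of the totally ordered lattice $\{0,1\}$. In particular it is a finite distributive lattice. -/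

import Mathlib

open scoped TensorProduct Pointwise

universe u v w

noncomputable section

namespace RelativeBGroups

/-! ## Finite sets with a group action and the Burnside group -/

/-- A finite (left) `G`-set. -/
structure FinGSet (G : Type u) [Group G] : Type (u + 1) where
  carrier : Type u
  [action : MulAction G carrier]
  [finite : Finite carrier]

attribute [instance] FinGSet.action FinGSet.finite

namespace FinGSet

variable {G H : Type u} [Group G] [Group H]

/-- Isomorphism of `G`-sets: an equivariant bijection. -/
def Iso (X Y : FinGSet G) : Prop :=
  ∃ e : X.carrier ≃ Y.carrier, ∀ (g : G) (x : X.carrier), e (g • x) = g • e x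

instance setoid (G : Type u) [Group G] : Setoid (FinGSet G) where
  r := Iso
  iseqv :=
    { refl := fun _ => ⟨Equiv.refl _, fun _ _ => rfl⟩
      symm := by
        rintro X Y ⟨e, he⟩
        exact ⟨e.symm, fun g y => by rw [Equiv.symm_apply_eq, he, e.apply_symm_apply]⟩
      trans := by
        rintro X Y Z ⟨e, he⟩ ⟨f, hf⟩
        exact ⟨e.trans f, fun g x => by simp [he, hf]⟩ }

/-- The empty `G`-set. -/
def empty (G : Type u) [Group G] : FinGSet G :=
  letI : MulAction G PEmpty.{u + 1} :=
    { smul := fun _ x => x, one_smul := fun _ => rfl, mul_smul := fun _ _ _ => rfl }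
  { carrier := PEmpty }

/-- The disjoint union of two `G`-sets. -/
def sum (X Y : FinGSet G) : FinGSet G where
  carrier := X.carrier ⊕ Y.carrier

/-- The cartesian product of a `G`-set and an `H`-set, as a `(G × H)`-set. -/
def prod (X : FinGSet G) (Y : FinGSet H) : FinGSet (G × H) :=
  letI : MulAction (G × H) (X.carrier × Y.carrier) :=
    { smul := fun a z => (a.1 • z.1, a.2 • z.2)
      one_smul := fun z => Prod.ext (one_smul G z.1) (one_smul H z.2)
      mul_smul := fun a b z => Prod.ext (mul_smul a.1 b.1 z.1) (mul_smul a.2 b.2 z.2) }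
  { carrier := X.carrier × Y.carrier }

/-- The `H`-set obtained from a `G`-set by letting `H` act through `f : H → G`. -/
def comap (f : H →* G) (X : FinGSet G) : FinGSet H :=
  letI : MulAction H X.carrier := MulAction.compHom X.carrier f
  { carrier := X.carrier }

end FinGSet

/-- Isomorphism classes of finite `G`-sets. -/
def IsoClass (G : Type u) [Group G] : Type (u + 1) := Quotient (FinGSet.setoid G)

/-- The isomorphism class of a finite `G`-set. -/
def isoClass {G : Type u} [Group G] (X : FinGSet G) : IsoClass G := Quotient.mk _ X

instance (G : Type u) [Group G] : Zero (IsoClass G) := ⟨isoClass (FinGSet.empty G)⟩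

instance (G : Type u) [Group G] : Add (IsoClass G) where
  add := Quotient.map₂ FinGSet.sum (by
    rintro X X' ⟨e, he⟩ Y Y' ⟨f, hf⟩
    refine ⟨Equiv.sumCongr e f, ?_⟩
    rintro g (x | y)
    · exact congrArg Sum.inl (he g x)
    · exact congrArg Sum.inr (hf g y))

/-- Isomorphism classes of finite `G`-sets form a commutative monoid under disjoint union. -/
instance (G : Type u) [Group G] : AddCommMonoid (IsoClass G) where
  nsmul := nsmulRec
  add_assoc := by
    rintro ⟨X⟩ ⟨Y⟩ ⟨Z⟩
    refine Quotient.sound ⟨Equiv.sumAssoc _ _ _, ?_⟩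
    rintro g ((x | y) | z) <;> rfl
  zero_add := by
    rintro ⟨X⟩
    refine Quotient.sound ⟨Equiv.emptySum PEmpty X.carrier, ?_⟩
    rintro g (x | x)
    · exact x.elim
    · rfl
  add_zero := by
    rintro ⟨X⟩
    refine Quotient.sound ⟨Equiv.sumEmpty X.carrier PEmpty, ?_⟩
    rintro g (x | x)
    · rfl
    · exact x.elim
  add_comm := by
    rintro ⟨X⟩ ⟨Y⟩
    refine Quotient.sound ⟨Equiv.sumComm _ _, ?_⟩
    rintro g (x | x) <;> rfl

/-- The cartesian product of an isomorphism class of `G`-sets and one of `H`-sets;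
it is biadditive. -/
def IsoClass.prod {G H : Type u} [Group G] [Group H] :
    IsoClass G →+ IsoClass H →+ IsoClass (G × H) where
  toFun a :=
    { toFun := fun b => Quotient.map₂ FinGSet.prod (by
        rintro X X' ⟨e, he⟩ Y Y' ⟨f, hf⟩
        exact ⟨Equiv.prodCongr e f, fun g z => Prod.ext (he g.1 z.1) (hf g.2 z.2)⟩) a b
      map_zero' := by
        obtain ⟨X⟩ := a
        exact Quotient.sound ⟨Equiv.prodPEmpty X.carrier |>.trans (Equiv.refl _),
          fun _ z => z.2.elim⟩
      map_add' := by
        obtain ⟨X⟩ := a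
        rintro ⟨Y⟩ ⟨Z⟩
        refine Quotient.sound ⟨Equiv.prodSumDistrib _ _ _, ?_⟩
        rintro g ⟨x, (y | z)⟩ <;> rfl }
  map_zero' := by
    ext ⟨Y⟩
    exact Quotient.sound ⟨Equiv.pemptyProd Y.carrier |>.trans (Equiv.refl _),
      fun _ z => z.1.elim⟩
  map_add' := by
    rintro ⟨X⟩ ⟨Y⟩
    ext ⟨Z⟩
    refine Quotient.sound ⟨Equiv.sumProdDistrib _ _ _, ?_⟩
    rintro g ⟨(x | y), z⟩ <;> rfl

/-- Restriction of isomorphism classes of `G`-sets along a homomorphism `H → G`. -/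
def IsoClass.comap {G H : Type u} [Group G] [Group H] (f : H →* G) :
    IsoClass G →+ IsoClass H where
  toFun := Quotient.map (FinGSet.comap f) (by
    rintro X X' ⟨e, he⟩
    exact ⟨e, fun h x => he (f h) x⟩)
  map_zero' := Quotient.sound ⟨Equiv.refl _, fun _ z => z.elim⟩
  map_add' := by
    rintro ⟨X⟩ ⟨Y⟩
    refine Quotient.sound ⟨Equiv.refl _, ?_⟩
    rintro h (x | y) <;> rfl

/-- The Burnside group `B(G)`: the Grothendieck group of finite `G`-sets. -/
abbrev BurnsideGroup (G : Type u) [Group G] : Type (u + 1) :=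
  Algebra.GrothendieckAddGroup (IsoClass G)

/-- `𝔽B(G) = 𝔽 ⊗ B(G)`. -/
abbrev FB (F : Type v) [Field F] (G : Type u) [Group G] : Type (max v (u + 1)) :=
  F ⊗[ℤ] BurnsideGroup G

namespace FB

variable (F : Type v) [Field F]

/-- The class in `𝔽B(G)` of an isomorphism class of `G`-sets. -/
def cls (G : Type u) [Group G] : IsoClass G →+ FB F G where
  toFun a := (1 : F) ⊗ₜ[ℤ] Algebra.GrothendieckAddGroup.of a
  map_zero' := by rw [map_zero, TensorProduct.tmul_zero]
  map_add' a b := by rw [map_add, TensorProduct.tmul_add]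

variable {F}

/-- The linear extension to `𝔽B(G)` of an additive function of finite `G`-sets. -/
def lift {G : Type u} [Group G] {V : Type w} [AddCommGroup V] [Module F V]
    (f : IsoClass G →+ V) : FB F G →ₗ[F] V :=
  LinearMap.liftBaseChange F (Algebra.GrothendieckAddGroup.lift f).toIntLinearMap

theorem lift_cls {G : Type u} [Group G] {V : Type w} [AddCommGroup V] [Module F V]
    (f : IsoClass G →+ V) (a : IsoClass G) : lift f (cls F G a) = f a := by
  have : Algebra.GrothendieckAddGroup.lift f (Algebra.GrothendieckAddGroup.of a) = f a :=
    DFunLike.congr_fun (Algebra.GrothendieckAddGroup.lift.symm_apply_apply f) a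
  simpa [lift, cls] using this

theorem lift_unique {G : Type u} [Group G] {V : Type w} [AddCommGroup V] [Module F V]
    {s t : FB F G →ₗ[F] V} (h : ∀ a, s (cls F G a) = t (cls F G a)) : s = t := by
  apply (LinearMap.liftBaseChangeEquiv (R := ℤ) (M := BurnsideGroup G) (N := V) F).symm.injective
  apply LinearMap.toAddMonoidHom_injective
  apply Algebra.GrothendieckAddGroup.lift.symm.injective
  ext a
  exact h a

/-- The external product `𝔽B(G) × 𝔽B(H) → 𝔽B(G × H)`, induced by `(X, Y) ↦ X × Y`. -/
def prod {G H : Type u} [Group G] [Group H] : FB F G →ₗ[F] FB F H →ₗ[F] FB F (G × H) :=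
  lift
    { toFun := fun a => lift ((cls F (G × H)).comp (IsoClass.prod a))
      map_zero' := lift_unique fun b => by simp [lift_cls]
      map_add' := fun a a' => lift_unique fun b => by simp [lift_cls] }

/-- Restriction `𝔽B(G) → 𝔽B(H)` along a homomorphism `H → G`. -/
def comap {G H : Type u} [Group G] [Group H] (f : H →* G) : FB F G →ₗ[F] FB F H :=
  lift ((cls F H).comp (IsoClass.comap f))

end FB

/-! ## Bisets -/

/-- A finite `(H, G)`-biset: a finite set with commuting left `H`- and right `G`-actions. -/
structure Biset (H G : Type u) [Group H] [Group G] : Type (u + 1) where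
  carrier : Type u
  [left : MulAction H carrier]
  [right : MulAction Gᵐᵒᵖ carrier]
  [comm : SMulCommClass H Gᵐᵒᵖ carrier]
  [finite : Finite carrier]

attribute [instance] Biset.left Biset.right Biset.comm Biset.finite

namespace Biset

variable {G H : Type u} [Group G] [Group H]

/-- Two elements of `U × X` are identified in `U ×_G X` when they lie in the same orbit for
`(u, x) · g = (u g, g⁻¹ x)`. -/
def tensorSetoid (U : Biset H G) (X : FinGSet G) : Setoid (U.carrier × X.carrier) where
  r z w := ∃ g : G, w = (MulOpposite.op g • z.1, g⁻¹ • z.2)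
  iseqv :=
    { refl := fun z => ⟨1, by simp⟩
      symm := by
        rintro z w ⟨g, rfl⟩
        exact ⟨g⁻¹, by simp [smul_smul]⟩
      trans := by
        rintro z w t ⟨g, rfl⟩ ⟨g', rfl⟩
        exact ⟨g * g', by simp [smul_smul]⟩ }

/-- The `H`-set `U ×_G X`. -/
def tensor (U : Biset H G) (X : FinGSet G) : FinGSet H :=
  letI : MulAction H (Quotient (tensorSetoid U X)) :=
    { smul := fun h => Quotient.map (fun z => (h • z.1, z.2)) (by
        rintro z w ⟨g, rfl⟩
        exact ⟨g, by simp [smul_comm h]⟩)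
      one_smul := by
        rintro ⟨z⟩
        exact congrArg (Quotient.mk (tensorSetoid U X)) (Prod.ext (one_smul H z.1) rfl)
      mul_smul := by
        rintro h h' ⟨z⟩
        exact congrArg (Quotient.mk (tensorSetoid U X)) (Prod.ext (mul_smul h h' z.1) rfl) }
  { carrier := Quotient (tensorSetoid U X) }

/-- `X ↦ U ×_G X` on isomorphism classes. -/
def tensorHom (U : Biset H G) : IsoClass G →+ IsoClass H where
  toFun := Quotient.map U.tensor (by
    rintro X X' ⟨e, he⟩
    refine ⟨Quotient.congr (Equiv.prodCongr (Equiv.refl _) e) ?_, ?_⟩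
    · intro z w
      constructor
      · rintro ⟨g, rfl⟩
        exact ⟨g, by simp [he]⟩
      · rintro ⟨g, hg⟩
        refine ⟨g, ?_⟩
        apply (Equiv.prodCongr (Equiv.refl U.carrier) e).injective
        rw [hg]
        simp [he]
    · rintro h ⟨z⟩
      rfl)
  map_zero' := by
    refine Quotient.sound ⟨⟨fun z => ?_, fun z => z.elim, fun z => ?_, fun z => z.elim⟩, ?_⟩
    · exact (Quotient.out z).2
    · exact (Quotient.out z).2.elim
    · exact fun _ z => (Quotient.out z).2.elim
  map_add' := by
    rintro ⟨X⟩ ⟨Y⟩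
    refine Quotient.sound ⟨⟨?_, ?_, ?_, ?_⟩, ?_⟩
    · refine Quotient.lift (fun z => z.2.elim
        (fun x => Sum.inl (Quotient.mk (tensorSetoid U X) (z.1, x)))
        (fun y => Sum.inr (Quotient.mk (tensorSetoid U Y) (z.1, y)))) ?_
      rintro ⟨u, (x | y)⟩ w ⟨g, rfl⟩
      · exact congrArg Sum.inl (Quotient.sound ⟨g, rfl⟩)
      · exact congrArg Sum.inr (Quotient.sound ⟨g, rfl⟩)
    · refine Sum.elim
        (Quotient.map (fun z => (z.1, Sum.inl z.2)) ?_)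
        (Quotient.map (fun z => (z.1, Sum.inr z.2)) ?_)
      · rintro z w ⟨g, rfl⟩
        exact ⟨g, rfl⟩
      · rintro z w ⟨g, rfl⟩
        exact ⟨g, rfl⟩
    · rintro ⟨u, (x | y)⟩ <;> rfl
    · rintro (z | z)
      · obtain ⟨z, rfl⟩ := Quotient.exists_rep (s := tensorSetoid U X) z
        rfl
      · obtain ⟨z, rfl⟩ := Quotient.exists_rep (s := tensorSetoid U Y) z
        rfl
    · rintro h ⟨u, (x | y)⟩ <;> rfl

/-- The map `𝔽B(U) : 𝔽B(G) → 𝔽B(H)` attached to a finite `(H, G)`-biset `U`, induced by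
`X ↦ U ×_G X`. -/
def map (F : Type v) [Field F] (U : Biset H G) : FB F G →ₗ[F] FB F H :=
  FB.lift ((FB.cls F H).comp U.tensorHom)

/-- The `(H × K, G × K)`-biset `U × K`, with `K` acting on both sides on the second component by
multiplication. -/
def shift (K : Type u) [Group K] [Finite K] (U : Biset H G) : Biset (H × K) (G × K) :=
  letI : MulAction (H × K) (U.carrier × K) :=
    { smul := fun a z => (a.1 • z.1, a.2 * z.2)
      one_smul := fun z => Prod.ext (one_smul H z.1) (one_mul z.2)
      mul_smul := fun a b z => Prod.ext (mul_smul a.1 b.1 z.1) (mul_assoc a.2 b.2 z.2) }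
  letI : MulAction (G × K)ᵐᵒᵖ (U.carrier × K) :=
    { smul := fun a z => (MulOpposite.op a.unop.1 • z.1, z.2 * a.unop.2)
      one_smul := fun z => Prod.ext (one_smul Gᵐᵒᵖ z.1) (mul_one z.2)
      mul_smul := fun a b z => Prod.ext
        (mul_smul (MulOpposite.op a.unop.1) (MulOpposite.op b.unop.1) z.1)
        (mul_assoc z.2 b.unop.2 a.unop.2).symm }
  haveI : SMulCommClass (H × K) (G × K)ᵐᵒᵖ (U.carrier × K) :=
    ⟨fun a b z => Prod.ext (smul_comm a.1 (MulOpposite.op b.unop.1) z.1)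
      (mul_assoc a.2 z.2 b.unop.2).symm⟩
  { carrier := U.carrier × K }

end Biset

/-! ## The shifted Burnside functor and its ideals over finite `p`-groups -/

/-- The homomorphism `(g, h, k) ↦ ((g, k), (h, k))`, an isomorphism from `G × H × K` onto the
subgroup `Δ` of `(G × K) × (H × K)`. -/
def diagHom (G H K : Type u) [Group G] [Group H] [Group K] :
    (G × H) × K →* (G × K) × (H × K) where
  toFun a := ((a.1.1, a.2), (a.1.2, a.2))
  map_one' := rfl
  map_mul' _ _ := rfl

/-- The product `𝔽B_K(G) × 𝔽B_K(H) → 𝔽B_K(G × H)` of the Green biset functor `𝔽B_K`, where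
`𝔽B_K(G) = 𝔽B(G × K)`: the external product in `𝔽B((G × K) × (H × K))`, restricted to `Δ` and
transported to `(G × H) × K`. -/
def shiftProd {F : Type v} [Field F] {G H K : Type u} [Group G] [Group H] [Group K]
    (a : FB F (G × K)) (b : FB F (H × K)) : FB F ((G × H) × K) :=
  FB.comap (diagHom G H K) (FB.prod a b)

theorem shiftProd_add_left {F : Type v} [Field F] {G H K : Type u} [Group G] [Group H] [Group K]
    (a a' : FB F (G × K)) (b : FB F (H × K)) :
    shiftProd (a + a') b = shiftProd a b + shiftProd a' b := by
  simp [shiftProd]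

theorem shiftProd_add_right {F : Type v} [Field F] {G H K : Type u} [Group G] [Group H] [Group K]
    (a : FB F (G × K)) (b b' : FB F (H × K)) :
    shiftProd a (b + b') = shiftProd a b + shiftProd a b' := by
  simp [shiftProd]

theorem isPGroup_prod {p : ℕ} {G H : Type u} [Group G] [Group H]
    (hG : IsPGroup p G) (hH : IsPGroup p H) : IsPGroup p (G × H) := by
  rintro ⟨g, h⟩
  obtain ⟨m, hm⟩ := hG g
  obtain ⟨n, hn⟩ := hH h
  refine ⟨m + n, Prod.ext ?_ ?_⟩
  · simp [pow_add, pow_mul, hm]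
  · simp [pow_add, mul_comm (p ^ m), pow_mul, hn]

/-- An ideal of the Green biset functor `𝔽B_K^{(p)}` on finite `p`-groups: a family of subspaces
of the spaces `𝔽B_K(G)`, `G` a finite `p`-group, which is stable under all the maps
`𝔽B_K(U) = 𝔽B(U × K)` for `U` a finite biset (hence, by linearity, under all linear combinations
of such maps, i.e. a biset subfunctor), and under multiplication by arbitrary elements on either
side. -/
@[ext]
structure GreenIdeal (F : Type v) [Field F] (p : ℕ) (K : Type u) [Group K] [Finite K] where
  carrier : ∀ (G : Type u) [Group G] [Finite G], IsPGroup p G → Submodule F (FB F (G × K))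
  map_mem : ∀ (G H : Type u) [Group G] [Finite G] [Group H] [Finite H]
    (hG : IsPGroup p G) (hH : IsPGroup p H) (U : Biset H G) (a : FB F (G × K)),
    a ∈ carrier G hG → (U.shift K).map F a ∈ carrier H hH
  prod_mem_left : ∀ (G H : Type u) [Group G] [Finite G] [Group H] [Finite H]
    (hG : IsPGroup p G) (hH : IsPGroup p H) (a : FB F (G × K)) (b : FB F (H × K)),
    b ∈ carrier H hH → shiftProd a b ∈ carrier (G × H) (isPGroup_prod hG hH)
  prod_mem_right : ∀ (G H : Type u) [Group G] [Finite G] [Group H] [Finite H]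
    (hG : IsPGroup p G) (hH : IsPGroup p H) (a : FB F (G × K)) (b : FB F (H × K)),
    a ∈ carrier G hG → shiftProd a b ∈ carrier (G × H) (isPGroup_prod hG hH)

namespace GreenIdeal

variable {F : Type v} [Field F] {p : ℕ} {K : Type u} [Group K] [Finite K]

/-- Inclusion of ideals. -/
instance : PartialOrder (GreenIdeal F p K) where
  le I J := ∀ (G : Type u) [Group G] [Finite G] (hG : IsPGroup p G), I.carrier G hG ≤ J.carrier G hG
  le_refl _ _ _ _ _ := le_rfl
  le_trans _ _ _ h h' G _ _ hG := (h G hG).trans (h' G hG)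
  le_antisymm I J h h' := by
    ext G _ _ hG : 5
    exact le_antisymm (h G hG) (h' G hG)

/-- The lattice of ideals: meets are intersections and joins are sums, evaluated groupwise. -/
instance : Lattice (GreenIdeal F p K) where
  inf I J :=
    { carrier := fun G _ _ hG => I.carrier G hG ⊓ J.carrier G hG
      map_mem := fun G H _ _ _ _ hG hH U a h =>
        ⟨I.map_mem G H hG hH U a h.1, J.map_mem G H hG hH U a h.2⟩
      prod_mem_left := fun G H _ _ _ _ hG hH a b h =>
        ⟨I.prod_mem_left G H hG hH a b h.1, J.prod_mem_left G H hG hH a b h.2⟩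
      prod_mem_right := fun G H _ _ _ _ hG hH a b h =>
        ⟨I.prod_mem_right G H hG hH a b h.1, J.prod_mem_right G H hG hH a b h.2⟩ }
  sup I J :=
    { carrier := fun G _ _ hG => I.carrier G hG ⊔ J.carrier G hG
      map_mem := fun G H _ _ _ _ hG hH U a h => by
        obtain ⟨x, hx, y, hy, rfl⟩ := Submodule.mem_sup.mp h
        rw [map_add]
        exact Submodule.add_mem_sup (I.map_mem G H hG hH U x hx) (J.map_mem G H hG hH U y hy)
      prod_mem_left := fun G H _ _ _ _ hG hH a b h => by
        obtain ⟨x, hx, y, hy, rfl⟩ := Submodule.mem_sup.mp h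
        rw [shiftProd_add_right]
        exact Submodule.add_mem_sup (I.prod_mem_left G H hG hH a x hx)
          (J.prod_mem_left G H hG hH a y hy)
      prod_mem_right := fun G H _ _ _ _ hG hH a b h => by
        obtain ⟨x, hx, y, hy, rfl⟩ := Submodule.mem_sup.mp h
        rw [shiftProd_add_left]
        exact Submodule.add_mem_sup (I.prod_mem_right G H hG hH x b hx)
          (J.prod_mem_right G H hG hH y b hy) }
  inf_le_left _ _ _ _ _ _ := inf_le_left
  inf_le_right _ _ _ _ _ _ := inf_le_right
  le_inf _ _ _ h h' G _ _ hG := le_inf (h G hG) (h' G hG)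
  le_sup_left _ _ _ _ _ _ := le_sup_left
  le_sup_right _ _ _ _ _ _ := le_sup_right
  sup_le _ _ _ h h' G _ _ hG := sup_le (h G hG) (h' G hG)

end GreenIdeal

/-! ## Counting conjugacy classes of subgroups -/

/-- `O^p(L)`, the subgroup generated by the `p'`-elements of the finite group `L`. -/
def pResidual (p : ℕ) (L : Type u) [Group L] : Subgroup L :=
  Subgroup.closure {x : L | ¬ p ∣ orderOf x}

instance (p : ℕ) (L : Type u) [Group L] : (pResidual p L).Normal where
  conj_mem n hn g := by
    induction hn using Subgroup.closure_induction with
    | mem x hx =>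
      refine Subgroup.subset_closure ?_
      have : orderOf (g * x * g⁻¹) = orderOf x :=
        orderOf_injective (MulAut.conj g).toMonoidHom (MulAut.conj g).injective x
      show ¬ p ∣ _
      rw [this]
      exact hx
    | one => simp
    | mul x y _ _ hx hy =>
      have : g * (x * y) * g⁻¹ = (g * x * g⁻¹) * (g * y * g⁻¹) := by group
      exact this ▸ mul_mem hx hy
    | inv x _ hx =>
      have : g * x⁻¹ * g⁻¹ = (g * x * g⁻¹)⁻¹ := by group
      exact this ▸ inv_mem hx

/-- The conjugacy classes of subgroups of `K`: orbits under conjugation. -/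
abbrev SubgroupClass (K : Type u) [Group K] : Type u :=
  MulAction.orbitRel.Quotient (ConjAct K) (Subgroup K)

/-- `c_K`: the number of conjugacy classes of subgroups `H` of `K` with `H / O^p(H)` cyclic. -/
def cycCount (p : ℕ) (K : Type u) [Group K] : ℕ :=
  Nat.card {C : SubgroupClass K //
    ∃ H : Subgroup K, Quotient.mk _ H = C ∧ IsCyclic (H ⧸ pResidual p H)}

/-- `nc_K`: the number of conjugacy classes of subgroups `H` of `K` with `H / O^p(H)` not
cyclic. -/
def noncycCount (p : ℕ) (K : Type u) [Group K] : ℕ :=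
  Nat.card {C : SubgroupClass K //
    ∃ H : Subgroup K, Quotient.mk _ H = C ∧ ¬ IsCyclic (H ⧸ pResidual p H)}

end RelativeBGroups

end

noncomputable section

namespace RelativeBGroups

/-! In characteristic `0` the marks `X ↦ |X^L|` identify `𝔽B(G × K)` with the functions on conjugacy
classes of subgroups `L ≤ G × K`, because the table of marks is triangular. The product of an ideal,
restricted along the diagonal of `G`, is pointwise multiplication. Hence `I(G)` is spanned by the
primitive idempotents it contains, and `I` is the same thing as its support: the set of `L`, for
varying `G`, at which some element of `I(G)` has a nonzero mark (`GreenIdeal.mem_iff`).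

Whether `L` lies in the support of `I` depends only on the class in `K` of its projection and on
whether `L` is `p`-cyclic, that is, `L / O^p(L)` is cyclic. If `L` is `p`-cyclic and in the support,
the one-point biset followed by inflation reaches every `M`, over any `p`-group, with the same
projection (`Supp.of_isPCyclic`). If `L` is arbitrary, every `M` with the same projection that is
not `p`-cyclic is reached by pulling back to the fibre product of `M` and `L` over `K` and deflating
to `M` (`Supp.of_not_isPCyclic`). Deflation is done through central kernels `Z` of order `p`. There
`Biset.mark_push` shows that the coefficient of an idempotent can vanish only if `L` contains `Z`
and `Z` has exactly `p` complements in `L`. These complements correspond to homomorphisms from one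
of them to `Z`, so a complement is then `p`-cyclic, and so is the image of `L`.

Thus an ideal is given by the set `B` of classes below its support and the subset `A ⊆ B` of classes
below its `p`-cyclic support; `A` contains only classes of `p`-cyclic subgroups of `K`. Every such
pair occurs (`ofClasses`). The condition on `B` is stable under bisets by the Frobenius relation
over `𝔽B(K)`, and the condition on `A` by the formula `Biset.mark_cyclicOver`. A `p`-cyclic class
therefore has three states (outside `B`, in `B` only, in `A`) and any other class has two. -/

/-! ## Marks -/

/-- The points of a `G`-set fixed by a subgroup. -/
def FinGSet.fixed {G : Type u} [Group G] (X : FinGSet G) (L : Subgroup G) : Set X.carrier :=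
  {x | ∀ l ∈ L, l • x = x}

theorem FinGSet.mem_fixed {G : Type u} [Group G] {X : FinGSet G} {L : Subgroup G}
    {x : X.carrier} : x ∈ X.fixed L ↔ ∀ l ∈ L, l • x = x := Iff.rfl

/-- The number of points fixed by `L`, as an additive function of isomorphism classes. -/
def IsoClass.mark {G : Type u} [Group G] (L : Subgroup G) : IsoClass G →+ ℕ where
  toFun := Quotient.lift (fun X : FinGSet G => Nat.card (X.fixed L)) (by
    rintro X Y ⟨e, he⟩
    refine Nat.card_congr (e.subtypeEquiv fun x => ?_)
    simp only [FinGSet.mem_fixed, ← he, e.apply_eq_iff_eq])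
  map_zero' := by
    have : IsEmpty (FinGSet.empty G).carrier := inferInstanceAs (IsEmpty PEmpty)
    exact Nat.card_of_isEmpty
  map_add' := by
    rintro ⟨X⟩ ⟨Y⟩
    show Nat.card ((X.sum Y).fixed L) = Nat.card (X.fixed L) + Nat.card (Y.fixed L)
    rw [← Nat.card_sum]
    refine Nat.card_congr ?_
    refine (Equiv.subtypeSum (α := X.carrier) (β := Y.carrier)).trans (Equiv.sumCongr ?_ ?_)
    · refine Equiv.subtypeEquivRight fun x => ?_
      exact forall₂_congr fun l _ => Sum.inl_injective.eq_iff
    · refine Equiv.subtypeEquivRight fun x => ?_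
      exact forall₂_congr fun l _ => Sum.inr_injective.eq_iff

variable {F : Type v} [Field F]

/-- The mark at a subgroup `L`: the linear extension of `X ↦ |X^L|`. -/
def FB.mark {G : Type u} [Group G] (L : Subgroup G) : FB F G →ₗ[F] F :=
  FB.lift ((Nat.castAddMonoidHom F).comp (IsoClass.mark L))

/-- The class in `𝔽B(G)` of a finite `G`-set. -/
def FB.of (F : Type v) [Field F] {G : Type u} [Group G] (X : FinGSet G) : FB F G :=
  FB.cls F G (isoClass X)

theorem FB.mark_of {G : Type u} [Group G] (L : Subgroup G) (X : FinGSet G) :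
    FB.mark L (FB.of F X) = (Nat.card (X.fixed L) : F) :=
  FB.lift_cls _ _

theorem FB.hom_ext {G : Type u} [Group G] {V : Type w} [AddCommGroup V] [Module F V]
    {s t : FB F G →ₗ[F] V} (h : ∀ X : FinGSet G, s (FB.of F X) = t (FB.of F X)) : s = t :=
  FB.lift_unique fun a => Quotient.inductionOn a h

theorem FB.comap_of {G H : Type u} [Group G] [Group H] (f : H →* G) (X : FinGSet G) :
    FB.comap f (FB.of F X) = FB.of F (X.comap f) :=
  FB.lift_cls _ _

theorem FB.prod_of {G H : Type u} [Group G] [Group H] (X : FinGSet G) (Y : FinGSet H) :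
    FB.prod (FB.of F X) (FB.of F Y) = FB.of F (X.prod Y) := by
  simp only [FB.prod, FB.of]
  rw [FB.lift_cls]
  exact FB.lift_cls _ _

theorem FB.map_of {G H : Type u} [Group G] [Group H] (U : Biset H G) (X : FinGSet G) :
    U.map F (FB.of F X) = FB.of F (U.tensor X) :=
  FB.lift_cls _ _

theorem FB.of_eq {G : Type u} [Group G] {X Y : FinGSet G} (h : X.Iso Y) :
    FB.of F X = FB.of F Y :=
  congrArg (FB.cls F G) (Quotient.sound h)

theorem FB.mark_comap {G H : Type u} [Group G] [Group H] (f : H →* G) (L : Subgroup H)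
    (x : FB F G) : FB.mark L (FB.comap f x) = FB.mark (L.map f) x := by
  suffices h : (FB.mark L).comp (FB.comap f) = FB.mark (F := F) (L.map f) from
    DFunLike.congr_fun h x
  refine FB.hom_ext fun X => ?_
  rw [LinearMap.comp_apply, FB.comap_of, FB.mark_of, FB.mark_of]
  congr 1
  refine Nat.card_congr (Equiv.subtypeEquivRight (p := (· ∈ (X.comap f).fixed L))
    (q := (· ∈ X.fixed (L.map f))) fun x => ?_)
  constructor
  · rintro h _ ⟨l, hl, rfl⟩
    exact h l hl
  · exact fun h l hl => h (f l) ⟨l, hl, rfl⟩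

theorem FB.mark_prod {G H : Type u} [Group G] [Group H] (T : Subgroup (G × H))
    (x : FB F G) (y : FB F H) :
    FB.mark T (FB.prod x y) =
      FB.mark (T.map (MonoidHom.fst G H)) x * FB.mark (T.map (MonoidHom.snd G H)) y := by
  suffices h : (FB.prod (F := F)).compr₂ (FB.mark T) =
      (LinearMap.mul F F).compl₁₂ (FB.mark (T.map (MonoidHom.fst G H)))
        (FB.mark (T.map (MonoidHom.snd G H))) from
    DFunLike.congr_fun (DFunLike.congr_fun h x) y
  refine FB.hom_ext fun X => FB.hom_ext fun Y => ?_
  simp only [LinearMap.compr₂_apply, LinearMap.compl₁₂_apply, LinearMap.mul_apply', FB.prod_of,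
    FB.mark_of]
  rw [← Nat.cast_mul, ← Nat.card_prod]
  congr 1
  refine Nat.card_congr ((Equiv.subtypeEquivRight (p := (· ∈ (X.prod Y).fixed T))
    (q := fun z : X.carrier × Y.carrier => z.1 ∈ X.fixed (T.map (MonoidHom.fst G H)) ∧
      z.2 ∈ Y.fixed (T.map (MonoidHom.snd G H))) fun z => ?_).trans Equiv.subtypeProdEquivProd)
  simp only [FinGSet.mem_fixed]
  constructor
  · intro h
    refine ⟨?_, ?_⟩
    · rintro _ ⟨l, hl, rfl⟩
      exact congrArg Prod.fst (h l hl)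
    · rintro _ ⟨l, hl, rfl⟩
      exact congrArg Prod.snd (h l hl)
  · exact fun h l hl => Prod.ext (h.1 _ ⟨l, hl, rfl⟩) (h.2 _ ⟨l, hl, rfl⟩)

theorem FB.mark_conj {G : Type u} [Group G] (g : ConjAct G) (L : Subgroup G) (x : FB F G) :
    FB.mark (g • L) x = FB.mark L x := by
  suffices h : FB.mark (F := F) (g • L) = FB.mark L from DFunLike.congr_fun h x
  refine FB.hom_ext fun X => ?_
  rw [FB.mark_of, FB.mark_of]
  congr 1
  symm
  refine Nat.card_congr ((MulAction.toPerm (ConjAct.ofConjAct g)).subtypeEquiv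
    (p := (· ∈ X.fixed L)) (q := (· ∈ X.fixed (g • L))) fun x => ?_)
  simp only [FinGSet.mem_fixed, MulAction.toPerm_apply, Subgroup.mem_smul_pointwise_iff_exists]
  constructor
  · rintro h _ ⟨l, hl, rfl⟩
    rw [ConjAct.smul_def, smul_smul, inv_mul_cancel_right, ← smul_smul, h l hl]
  · intro h l hl
    have := h _ ⟨l, hl, rfl⟩
    rwa [ConjAct.smul_def, smul_smul, inv_mul_cancel_right, ← smul_smul, smul_left_cancel_iff]
      at this

/-- The conjugacy class of a subgroup. -/
def subgroupClass {G : Type u} [Group G] (L : Subgroup G) : SubgroupClass G := Quotient.mk _ L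

theorem subgroupClass_eq_iff {G : Type u} [Group G] {L M : Subgroup G} :
    subgroupClass L = subgroupClass M ↔ ∃ g : ConjAct G, g • M = L :=
  Quotient.eq.trans MulAction.orbitRel_apply

theorem subgroupClass_smul {G : Type u} [Group G] (g : ConjAct G) (L : Subgroup G) :
    subgroupClass (g • L) = subgroupClass L :=
  subgroupClass_eq_iff.mpr ⟨g, rfl⟩

theorem subgroupClass_out {G : Type u} [Group G] (c : SubgroupClass G) :
    subgroupClass c.out = c := Quotient.out_eq _

theorem FB.mark_eq_of_class {G : Type u} [Group G] {L M : Subgroup G}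
    (h : subgroupClass L = subgroupClass M) (x : FB F G) : FB.mark L x = FB.mark M x := by
  obtain ⟨g, rfl⟩ := subgroupClass_eq_iff.mp h
  exact FB.mark_conj g M x

theorem card_eq_of_class {G : Type u} [Group G] {L M : Subgroup G}
    (h : subgroupClass L = subgroupClass M) : Nat.card L = Nat.card M := by
  obtain ⟨g, rfl⟩ := subgroupClass_eq_iff.mp h
  exact Nat.card_congr (Subgroup.equivSMul g M).symm.toEquiv

/-! ## The idempotent basis -/

/-- The transitive `G`-set `G / S`. -/
def FinGSet.coset {G : Type u} [Group G] [Finite G] (S : Subgroup G) : FinGSet G where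
  carrier := G ⧸ S

theorem FinGSet.exists_smul_le_of_fixed_coset {G : Type u} [Group G] [Finite G]
    {S T : Subgroup G} (h : ((coset S).fixed T).Nonempty) : ∃ g : ConjAct G, T ≤ g • S := by
  obtain ⟨x, hx⟩ := h
  obtain ⟨g, rfl⟩ := QuotientGroup.mk_surjective (s := S) x
  refine ⟨ConjAct.toConjAct g, fun t ht => ?_⟩
  rw [Subgroup.mem_pointwise_smul_iff_inv_smul_mem, ← map_inv, ConjAct.toConjAct_smul, inv_inv]
  have h1 : ((t * g : G) : G ⧸ S) = (g : G ⧸ S) := hx t ht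
  have h2 := QuotientGroup.eq.mp h1.symm
  rwa [← mul_assoc] at h2

theorem FinGSet.one_mem_fixed_coset {G : Type u} [Group G] [Finite G] (S : Subgroup G) :
    ((1 : G) : G ⧸ S) ∈ (coset S).fixed S := by
  intro s hs
  show ((s * 1 : G) : G ⧸ S) = ((1 : G) : G ⧸ S)
  rw [mul_one]
  exact (QuotientGroup.eq.mpr (by simpa using hs)).symm

/-- The restriction of the action to an invariant subset. -/
def FinGSet.sub {G : Type u} [Group G] (X : FinGSet G) (P : Set X.carrier)
    (hP : ∀ (g : G), ∀ x ∈ P, g • x ∈ P) : FinGSet G :=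
  letI : MulAction G P :=
    { smul := fun g x => ⟨g • x.1, hP g x.1 x.2⟩
      one_smul := fun x => Subtype.ext (one_smul G x.1)
      mul_smul := fun a b x => Subtype.ext (mul_smul a b x.1) }
  { carrier := P }

theorem FinGSet.iso_sum_sub {G : Type u} [Group G] (X : FinGSet G) (P : Set X.carrier)
    (hP : ∀ (g : G), ∀ x ∈ P, g • x ∈ P) (hP' : ∀ (g : G), ∀ x ∈ Pᶜ, g • x ∈ Pᶜ) :
    ((X.sub P hP).sum (X.sub Pᶜ hP')).Iso X := by
  classical
  refine ⟨Equiv.Set.sumCompl P, ?_⟩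
  rintro g (x | x)
  · rfl
  · rfl

theorem FinGSet.iso_coset {G : Type u} [Group G] [Finite G] (X : FinGSet G) (x : X.carrier)
    (hP : ∀ (g : G), ∀ y ∈ MulAction.orbit G x, g • y ∈ MulAction.orbit G x) :
    (X.sub (MulAction.orbit G x) hP).Iso (coset (MulAction.stabilizer G x)) := by
  refine ⟨MulAction.orbitEquivQuotientStabilizer G x, ?_⟩
  intro g y
  obtain ⟨y, rfl⟩ := (MulAction.orbitEquivQuotientStabilizer G x).symm.surjective y
  obtain ⟨h, rfl⟩ := QuotientGroup.mk_surjective (s := MulAction.stabilizer G x) y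
  set e := MulAction.orbitEquivQuotientStabilizer G x with he
  refine (e.symm_apply_eq.mp (Subtype.ext ?_)).symm
  show ((e.symm (g • e (e.symm h)) : MulAction.orbit G x) : X.carrier) =
    g • ((e.symm h : MulAction.orbit G x) : X.carrier)
  rw [Equiv.apply_symm_apply]
  show ((e.symm ((g * h : G) : G ⧸ _) : MulAction.orbit G x) : X.carrier) = _
  rw [MulAction.orbitEquivQuotientStabilizer_symm_apply,
    MulAction.orbitEquivQuotientStabilizer_symm_apply, mul_smul]

/-- The classes of the transitive sets `G / S`, for representatives `S` of the conjugacy classes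
of subgroups. -/
def FB.cosetBasis (F : Type v) [Field F] {G : Type u} [Group G] [Finite G]
    (c : SubgroupClass G) : FB F G :=
  FB.of F (FinGSet.coset c.out)

/-- Strong induction on the number of points: one orbit is split off and its complement is smaller.
-/
theorem FB.of_mem_span {G : Type u} [Group G] [Finite G] (n : ℕ) :
    ∀ X : FinGSet G, Nat.card X.carrier = n →
      FB.of F X ∈ Submodule.span F (Set.range (FB.cosetBasis F (G := G))) := by
  induction n using Nat.strong_induction_on with
  | _ n ih =>
    intro X hn
    rcases isEmpty_or_nonempty X.carrier with hX | ⟨⟨x₀⟩⟩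
    · have : FB.of F X = 0 := by
        have h0 : isoClass X = 0 := Quotient.sound
          ⟨(Equiv.equivPEmpty X.carrier).trans (Equiv.refl _), fun g x => (hX.false x).elim⟩
        rw [FB.of, h0, map_zero]
      rw [this]
      exact zero_mem _
    · obtain ⟨g, hg⟩ := subgroupClass_eq_iff.mp
        (subgroupClass_out (subgroupClass (MulAction.stabilizer G x₀)))
      -- Moving the base point inside its orbit conjugates the stabilizer, so it can be made equal
      -- to the chosen representative.
      obtain ⟨x, hx⟩ : ∃ x : X.carrier, MulAction.stabilizer G x =
          (subgroupClass (MulAction.stabilizer G x₀)).out := by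
        refine ⟨ConjAct.ofConjAct g • x₀, ?_⟩
        rw [MulAction.stabilizer_smul_eq_stabilizer_map_conj, ← hg]
        rfl
      have hP : ∀ (g : G), ∀ y ∈ MulAction.orbit G x, g • y ∈ MulAction.orbit G x :=
        fun g y hy => MulAction.mem_orbit_of_mem_orbit g hy
      have hP' : ∀ (g : G), ∀ y ∈ (MulAction.orbit G x)ᶜ, g • y ∈ (MulAction.orbit G x)ᶜ :=
        fun g y hy h => hy (by simpa using MulAction.mem_orbit_of_mem_orbit g⁻¹ h)
      rw [← FB.of_eq (X.iso_sum_sub _ hP hP')]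
      have hadd : FB.of F ((X.sub _ hP).sum (X.sub _ hP')) =
          FB.of F (X.sub _ hP) + FB.of F (X.sub _ hP') :=
        map_add (FB.cls F G) (isoClass (X.sub _ hP)) (isoClass (X.sub _ hP'))
      rw [hadd]
      refine add_mem ?_ (ih _ ?_ _ rfl)
      · rw [FB.of_eq (X.iso_coset x hP), hx]
        exact Submodule.subset_span ⟨_, rfl⟩
      · rw [← hn]
        exact Set.ncard_lt_card (s := (MulAction.orbit G x)ᶜ)
          (fun h => (h.symm ▸ Set.mem_univ x : x ∈ (MulAction.orbit G x)ᶜ)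
            (MulAction.mem_orbit_self x))

theorem FB.span_cosetBasis {G : Type u} [Group G] [Finite G] :
    Submodule.span F (Set.range (FB.cosetBasis F (G := G))) = ⊤ := by
  rw [← Submodule.ker_mkQ (Submodule.span F (Set.range (FB.cosetBasis F (G := G)))),
    LinearMap.ker_eq_top]
  refine FB.hom_ext fun X => ?_
  rw [LinearMap.zero_apply, Submodule.mkQ_apply, Submodule.Quotient.mk_eq_zero]
  exact FB.of_mem_span _ X rfl

instance {G : Type u} [Group G] [Finite G] : Finite (SubgroupClass G) :=
  Quotient.finite _

theorem FB.mark_cosetBasis_self [CharZero F] {G : Type u} [Group G] [Finite G]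
    (c : SubgroupClass G) : FB.mark c.out (FB.cosetBasis F c) ≠ 0 := by
  rw [FB.cosetBasis, FB.mark_of, Nat.cast_ne_zero, Nat.card_ne_zero]
  exact ⟨⟨⟨_, FinGSet.one_mem_fixed_coset _⟩⟩, Subtype.finite⟩

/-- Triangularity of the table of marks: `G / S` has a point fixed by `T` only if `T` is
subconjugate to `S`, and comparing orders turns this into conjugacy. -/
theorem FB.eq_of_mark_cosetBasis_ne_zero {G : Type u} [Group G] [Finite G]
    {c d : SubgroupClass G} (h : FB.mark c.out (FB.cosetBasis F d) ≠ 0)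
    (hcard : Nat.card d.out ≤ Nat.card c.out) : d = c := by
  have hne : ((FinGSet.coset d.out).fixed c.out).Nonempty := by
    rw [Set.nonempty_iff_ne_empty]
    intro h0
    rw [FB.cosetBasis, FB.mark_of, h0] at h
    simp at h
  obtain ⟨g, hg⟩ := FinGSet.exists_smul_le_of_fixed_coset hne
  have hc : Nat.card (g • d.out : Subgroup G) = Nat.card d.out :=
    card_eq_of_class (subgroupClass_smul g d.out)
  have := Subgroup.eq_of_le_of_card_ge hg (hc.trans_le hcard)
  rw [← subgroupClass_out c, ← subgroupClass_out d, this, subgroupClass_smul]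

/-- The marks at representatives of the conjugacy classes of a combination of transitive sets. -/
def FB.markMatrix (F : Type v) [Field F] (G : Type u) [Group G] [Finite G] :
    (SubgroupClass G → F) →ₗ[F] (SubgroupClass G → F) :=
  letI := Fintype.ofFinite (SubgroupClass G)
  (LinearMap.pi fun c => FB.mark c.out) ∘ₗ Fintype.linearCombination F (FB.cosetBasis F (G := G))

theorem FB.markMatrix_injective [CharZero F] {G : Type u} [Group G] [Finite G] :
    Function.Injective (FB.markMatrix F G) := by
  classical
  let _ := Fintype.ofFinite (SubgroupClass G)
  rw [← LinearMap.ker_eq_bot, LinearMap.ker_eq_bot']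
  intro a ha
  by_contra hne
  obtain ⟨c₀, hc₀⟩ := Function.ne_iff.mp hne
  -- At a subgroup of maximal order among those with nonzero coefficient, only its own coset space
  -- contributes to the mark.
  obtain ⟨c, hc, hmax⟩ := Finset.exists_max_image
    (Finset.univ.filter fun c => a c ≠ 0) (fun c => Nat.card c.out) ⟨c₀, by simpa using hc₀⟩
  have h : FB.markMatrix F G a c = 0 := congrFun ha c
  have h' : ∑ d, a d • FB.mark c.out (FB.cosetBasis F d) = 0 := by
    rw [← h]
    simp [FB.markMatrix, Fintype.linearCombination_apply, map_sum]
  rw [Finset.sum_eq_single c] at h'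
  · rcases smul_eq_zero.mp h' with h1 | h1
    · simp [h1] at hc
    · exact FB.mark_cosetBasis_self c h1
  · intro d _ hd
    by_cases had : a d = 0
    · rw [had, zero_smul]
    · by_contra h2
      refine hd (FB.eq_of_mark_cosetBasis_ne_zero (F := F) (fun h3 => h2 (by rw [h3, smul_zero]))
        (hmax d (by simpa using had)))
  · simp

theorem FB.ext_mark [CharZero F] {G : Type u} [Group G] [Finite G] {x y : FB F G}
    (h : ∀ L : Subgroup G, FB.mark L x = FB.mark L y) : x = y := by
  let _ := Fintype.ofFinite (SubgroupClass G)
  rw [← sub_eq_zero]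
  have hx : x - y ∈ Submodule.span F (Set.range (FB.cosetBasis F (G := G))) := by
    rw [FB.span_cosetBasis]
    trivial
  rw [← Fintype.range_linearCombination] at hx
  obtain ⟨a, ha⟩ := hx
  have : a = 0 := by
    apply FB.markMatrix_injective (F := F)
    rw [map_zero]
    funext c
    show FB.mark c.out (Fintype.linearCombination F (FB.cosetBasis F (G := G)) a) = 0
    rw [ha, map_sub, h, sub_self]
  rw [← ha, this, map_zero]

/-- There are elements with arbitrary marks, constant on conjugacy classes. -/
theorem FB.exists_mark_eq [CharZero F] {G : Type u} [Group G] [Finite G]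
    (m : SubgroupClass G → F) : ∃ x : FB F G, ∀ L, FB.mark L x = m (subgroupClass L) := by
  let _ := Fintype.ofFinite (SubgroupClass G)
  -- An injective endomorphism of a finite-dimensional space is onto.
  obtain ⟨a, ha⟩ := LinearMap.injective_iff_surjective.mp
    (FB.markMatrix_injective (F := F) (G := G)) m
  refine ⟨Fintype.linearCombination F (FB.cosetBasis F (G := G)) a, fun L => ?_⟩
  rw [← ha]
  exact FB.mark_eq_of_class (subgroupClass_out _).symm _

/-! ## Counting orbits -/

/-- Burnside's lemma for the orbits in an invariant set, presented as the fibres of a map. -/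
theorem card_orbits_mul_card {G Y Ω : Type*} [Group G] [Finite G] [MulAction G Y] [Finite Y]
    (π : Y → Ω) (hπ : Function.Surjective π)
    (hfib : ∀ y y', π y = π y' ↔ ∃ g : G, g • y = y') (P : Ω → Prop) :
    Nat.card {ω // P ω} * Nat.card G =
      Nat.card {z : G × Y // P (π z.2) ∧ z.1 • z.2 = z.2} := by
  let S : SubMulAction G Y :=
    { carrier := {y | P (π y)}
      smul_mem' := fun g y hy => by
        have : π y = π (g • y) := (hfib _ _).mpr ⟨g, rfl⟩
        exact (this ▸ hy : P (π (g • y))) }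
  have e₁ : MulAction.orbitRel.Quotient G S ≃ {ω // P ω} := by
    refine Equiv.ofBijective (Quotient.lift (fun y : S => (⟨π y.1, y.2⟩ : {ω // P ω})) ?_) ⟨?_, ?_⟩
    · rintro y y' ⟨g, rfl⟩
      exact Subtype.ext ((hfib _ _).mpr ⟨g, rfl⟩).symm
    · rintro ⟨y⟩ ⟨y'⟩ h
      obtain ⟨g, hg⟩ := (hfib _ _).mp (Subtype.ext_iff.mp h).symm
      exact Quotient.sound ⟨g, Subtype.ext hg⟩
    · rintro ⟨ω, hω⟩
      obtain ⟨y, rfl⟩ := hπ ω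
      exact ⟨Quotient.mk _ ⟨y, hω⟩, rfl⟩
  rw [← Nat.card_congr e₁, ← Nat.card_prod,
    ← Nat.card_congr (MulAction.sigmaFixedByEquivOrbitsProdGroup G S)]
  refine Nat.card_congr ⟨fun z => ⟨(z.1, z.2.1.1), z.2.1.2, congrArg Subtype.val z.2.2⟩,
    fun z => ⟨z.1.1, ⟨⟨z.1.2, z.2.1⟩, Subtype.ext z.2.2⟩⟩, fun _ => rfl, fun _ => rfl⟩

/-! ## Bisets -/

namespace Biset

variable {G H K : Type u} [Group G] [Group H] [Group K] [Finite K]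

/-- The class of `(u, x)` in `U ×_G X`. -/
def tmk (U : Biset H G) (X : FinGSet G) (u : U.carrier) (x : X.carrier) :
    (U.tensor X).carrier :=
  Quotient.mk (tensorSetoid U X) (u, x)

theorem tmk_surjective (U : Biset H G) (X : FinGSet G) (t : (U.tensor X).carrier) :
    ∃ u x, U.tmk X u x = t := by
  obtain ⟨⟨u, x⟩, rfl⟩ := Quotient.exists_rep (s := tensorSetoid U X) t
  exact ⟨u, x, rfl⟩

theorem tmk_eq_tmk {U : Biset H G} {X : FinGSet G} {u u' : U.carrier} {x x' : X.carrier} :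
    U.tmk X u x = U.tmk X u' x' ↔ ∃ g : G, u' = MulOpposite.op g • u ∧ x' = g⁻¹ • x := by
  refine (Quotient.eq (r := tensorSetoid U X)).trans ?_
  exact exists_congr fun g => Prod.ext_iff

/-- The class of `((u, 1), x)` in `(U × K) ×_{G × K} X`. -/
def smk (U : Biset H G) (X : FinGSet (G × K)) (u : U.carrier) (x : X.carrier) :
    ((U.shift K).tensor X).carrier :=
  (U.shift K).tmk X ((u, 1) : U.carrier × K) x

theorem tmk_shift (U : Biset H G) (X : FinGSet (G × K)) (u : U.carrier) (k : K)
    (x : X.carrier) :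
    (U.shift K).tmk X ((u, k) : U.carrier × K) x = U.smk X u (((1 : G), k) • x) := by
  refine tmk_eq_tmk.mpr ⟨((1 : G), k⁻¹), ?_, ?_⟩
  · show ((u, 1) : U.carrier × K) = (MulOpposite.op (1 : G) • u, k * k⁻¹)
    simp
  · rw [Prod.inv_mk, inv_one, inv_inv]

theorem smk_surjective (U : Biset H G) (X : FinGSet (G × K))
    (t : ((U.shift K).tensor X).carrier) : ∃ u x, U.smk X u x = t := by
  obtain ⟨⟨u, k⟩, x, rfl⟩ := tmk_surjective _ _ t
  exact ⟨_, _, (tmk_shift U X u k x).symm⟩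

theorem smk_eq_smk {U : Biset H G} {X : FinGSet (G × K)} {u u' : U.carrier}
    {x x' : X.carrier} : U.smk X u x = U.smk X u' x' ↔
      ∃ g : G, u' = MulOpposite.op g⁻¹ • u ∧ x' = (g, (1 : K)) • x := by
  refine tmk_eq_tmk.trans ⟨?_, ?_⟩
  · rintro ⟨⟨g, k⟩, hu, hx⟩
    have h1 : u' = MulOpposite.op g • u := congrArg Prod.fst hu
    have h2 : 1 = 1 * k := congrArg Prod.snd hu
    rw [one_mul] at h2
    subst h2
    refine ⟨g⁻¹, by rwa [inv_inv], by rwa [Prod.inv_mk, inv_one] at hx⟩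
  · rintro ⟨g, hu, hx⟩
    refine ⟨(g⁻¹, 1), Prod.ext hu ?_, by rwa [Prod.inv_mk, inv_one, inv_inv]⟩
    show (1 : K) = 1 * 1
    rw [one_mul]

theorem smul_smk (U : Biset H G) (X : FinGSet (G × K)) (h : H) (k : K) (u : U.carrier)
    (x : X.carrier) : (h, k) • U.smk X u x = U.smk X (h • u) (((1 : G), k) • x) := by
  rw [← tmk_shift]
  show (U.shift K).tmk X ((h • u, k * 1) : U.carrier × K) x = _
  rw [mul_one]

/-- The biset inducing restriction along a homomorphism `H → G`. -/
def pull [Finite G] (f : H →* G) : Biset H G :=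
  letI : MulAction H G := MulAction.compHom G f
  haveI : SMulCommClass H Gᵐᵒᵖ G := ⟨fun h g x => (mul_assoc (f h) x g.unop).symm⟩
  { carrier := G }

/-- The biset inducing deflation along a homomorphism `G → H`. -/
def push [Finite H] (q : G →* H) : Biset H G :=
  letI : MulAction Gᵐᵒᵖ H :=
    { smul := fun g x => x * q g.unop
      one_smul := fun x => by
        show x * q 1 = x
        rw [map_one, mul_one]
      mul_smul := fun a b x => by
        show x * q (b.unop * a.unop) = x * q b.unop * q a.unop
        rw [map_mul, mul_assoc] }
  haveI : SMulCommClass H Gᵐᵒᵖ H := ⟨fun h g x => (mul_assoc h x (q g.unop)).symm⟩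
  { carrier := H }

/-- The one-point biset. -/
def point (H G : Type u) [Group H] [Group G] : Biset H G :=
  letI : MulAction H PUnit.{u + 1} :=
    { smul := fun _ x => x, one_smul := fun _ => rfl, mul_smul := fun _ _ _ => rfl }
  letI : MulAction Gᵐᵒᵖ PUnit.{u + 1} :=
    { smul := fun _ x => x, one_smul := fun _ => rfl, mul_smul := fun _ _ _ => rfl }
  haveI : SMulCommClass H Gᵐᵒᵖ PUnit.{u + 1} := ⟨fun _ _ _ => rfl⟩
  { carrier := PUnit }

/-- `f × id`. -/
abbrev _root_.RelativeBGroups.prodId (K : Type u) [Group K] {G H : Type u} [Group G] [Group H]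
    (f : H →* G) : H × K →* G × K :=
  f.prodMap (MonoidHom.id K)

theorem pull_map [Finite G] (f : H →* G) (x : FB F (G × K)) :
    ((pull f).shift K).map F x = FB.comap (prodId K f) x := by
  suffices h : ((pull f).shift K).map F = FB.comap (F := F) (prodId K f) from
    DFunLike.congr_fun h x
  refine FB.hom_ext fun X => ?_
  rw [FB.map_of, FB.comap_of]
  refine (FB.of_eq ?_).symm
  let one : (pull f).carrier := (1 : G)
  refine ⟨Equiv.ofBijective (fun x : X.carrier => (pull f).smk X one x) ⟨?_, ?_⟩, ?_⟩
  · intro (x : X.carrier) (x' : X.carrier) h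
    obtain ⟨g, h1, h2⟩ := smk_eq_smk.mp h
    have h1 : (1 : G) = 1 * g⁻¹ := h1
    rw [one_mul, eq_comm, inv_eq_one] at h1
    subst h1
    rw [h2]
    exact (one_smul (G × K) (x : X.carrier)).symm
  · intro t
    obtain ⟨u, x, rfl⟩ := smk_surjective _ _ t
    let g : G := u
    exact ⟨(g, (1 : K)) • x, (smk_eq_smk.mpr ⟨g, (mul_inv_cancel g).symm, rfl⟩).symm⟩
  · rintro ⟨h, k⟩ (x : X.carrier)
    show (pull f).smk X one ((f h, k) • x) = (h, k) • (pull f).smk X one x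
    rw [smul_smk]
    refine (smk_eq_smk.mpr ⟨f h, ?_, ?_⟩).symm
    · show (1 : G) = f h * 1 * (f h)⁻¹
      rw [mul_one, mul_inv_cancel]
    · rw [smul_smul, Prod.mk_mul_mk, mul_one, one_mul]

theorem mark_pull [Finite G] (f : H →* G) (L : Subgroup (H × K)) (x : FB F (G × K)) :
    FB.mark L (((pull f).shift K).map F x) = FB.mark (L.map (prodId K f)) x := by
  rw [pull_map, FB.mark_comap]

end Biset

/-! ## Pointwise products and the Frobenius relation -/

/-- The product of the ring `𝔽B(G)`. -/
def FB.mul {G : Type u} [Group G] (x y : FB F G) : FB F G :=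
  FB.comap ((MonoidHom.id G).prod (MonoidHom.id G)) (FB.prod x y)

theorem FB.mark_mul {G : Type u} [Group G] (L : Subgroup G) (x y : FB F G) :
    FB.mark L (FB.mul x y) = FB.mark L x * FB.mark L y := by
  rw [FB.mul, FB.mark_comap, FB.mark_prod, Subgroup.map_map, Subgroup.map_map,
    MonoidHom.fst_comp_prod, MonoidHom.snd_comp_prod, Subgroup.map_id]

theorem mark_shiftProd {G H K : Type u} [Group G] [Group H] [Group K]
    (T : Subgroup ((G × H) × K)) (a : FB F (G × K)) (b : FB F (H × K)) :
    FB.mark T (shiftProd a b) =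
      FB.mark (T.map (prodId K (MonoidHom.fst G H))) a *
        FB.mark (T.map (prodId K (MonoidHom.snd G H))) b := by
  rw [shiftProd, FB.mark_comap, FB.mark_prod, Subgroup.map_map, Subgroup.map_map]
  rfl

/-- Holds because the shifted biset is free on the `K`-coordinate, so a factor coming from `K` can
be carried through. It lets idempotents of `𝔽B(K)` cut out the part of an element lying over one
class of `K`, compatibly with all bisets. -/
theorem Biset.frobenius {G H K : Type u} [Group G] [Group H] [Group K] [Finite K]
    (U : Biset H G) (x : FB F (G × K)) (z : FB F K) :
    (U.shift K).map F (FB.mul x (FB.comap (MonoidHom.snd G K) z)) =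
      FB.mul ((U.shift K).map F x) (FB.comap (MonoidHom.snd H K) z) := by
  let mulHom (A : Type u) [Group A] : FB F A →ₗ[F] FB F A →ₗ[F] FB F A :=
    (FB.prod (F := F)).compr₂ (FB.comap ((MonoidHom.id A).prod (MonoidHom.id A)))
  suffices h : ((mulHom (G × K)).compl₂ (FB.comap (MonoidHom.snd G K))).compr₂
      ((U.shift K).map F) =
      ((mulHom (H × K)).compl₂ (FB.comap (MonoidHom.snd H K))).comp ((U.shift K).map F) from
    DFunLike.congr_fun (DFunLike.congr_fun h x) z
  refine FB.hom_ext fun X => FB.hom_ext fun Z => ?_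
  simp only [mulHom, LinearMap.compr₂_apply, LinearMap.compl₂_apply, LinearMap.comp_apply,
    FB.comap_of, FB.prod_of, FB.map_of]
  refine FB.of_eq ?_
  let XZ : FinGSet (G × K) := (X.prod (Z.comap (MonoidHom.snd G K))).comap
    ((MonoidHom.id (G × K)).prod (MonoidHom.id (G × K)))
  let TZ : FinGSet (H × K) := (((U.shift K).tensor X).prod (Z.comap (MonoidHom.snd H K))).comap
    ((MonoidHom.id (H × K)).prod (MonoidHom.id (H × K)))
  -- The twist of `z` by the `K`-coordinate of the biset makes the map constant on orbits; on
  -- representatives `((u, 1), x)` it disappears.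
  let e : ((U.shift K).tensor XZ).carrier → TZ.carrier :=
    Quotient.lift (fun w : (U.carrier × K) × (X.carrier × Z.carrier) =>
      ((U.shift K).tmk X w.1 w.2.1, w.1.2 • w.2.2)) (by
      rintro ⟨⟨u, k⟩, x, z⟩ w ⟨⟨g, k'⟩, rfl⟩
      refine Prod.ext (tmk_eq_tmk.mpr ⟨(g, k'), rfl, rfl⟩) ?_
      have key : ∀ z : Z.carrier, k • z = (k * k') • k'⁻¹ • z := fun z => by
        rw [smul_smul, mul_inv_cancel_right]
      exact key z)
  have he : ∀ (u : U.carrier) (x : X.carrier) (z : Z.carrier),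
      e (U.smk XZ u ((x, z) : X.carrier × Z.carrier)) = (U.smk X u x, z) :=
    fun u x z => Prod.ext rfl (one_smul K z)
  refine ⟨Equiv.ofBijective e ⟨?_, ?_⟩, ?_⟩
  · intro t t' h
    obtain ⟨u, ⟨x, z⟩, rfl⟩ := smk_surjective _ _ t
    obtain ⟨u', ⟨x', z'⟩, rfl⟩ := smk_surjective _ _ t'
    have h' : ((U.smk X u x, z) : ((U.shift K).tensor X).carrier × Z.carrier) =
        (U.smk X u' x', z') := (he u x z).symm.trans (h.trans (he u' x' z'))
    obtain ⟨g, h1, h2⟩ := smk_eq_smk.mp (congrArg Prod.fst h')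
    have h3 : z = z' := congrArg Prod.snd h'
    refine smk_eq_smk.mpr ⟨g, h1, Prod.ext h2 ?_⟩
    exact h3.symm.trans (one_smul K (α := Z.carrier) z).symm
  · rintro ⟨t, z⟩
    obtain ⟨u, x, rfl⟩ := smk_surjective _ _ t
    exact ⟨U.smk XZ u ((x, z) : X.carrier × Z.carrier), he u x z⟩
  · rintro ⟨h, k⟩ t
    obtain ⟨⟨u, k'⟩, ⟨x, z⟩, rfl⟩ := tmk_surjective _ _ t
    refine Prod.ext rfl ?_
    exact mul_smul (β := Z.carrier) k k' z

/-! ## Marks of the image of an element under a biset, at `p`-residually cyclic subgroups -/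

theorem FinGSet.mem_fixed_closure {A : Type u} [Group A] {X : FinGSet A} {s : Set A}
    {x : X.carrier} : x ∈ X.fixed (Subgroup.closure s) ↔ ∀ a ∈ s, a • x = x :=
  (Subgroup.closure_le (MulAction.stabilizer A x) : _ ≤ _ ↔ _)

/-- The subgroup of `G × K` generated by `1 × N` and `(g, k)`. -/
def cyclicOver {G K : Type u} [Group G] [Group K] (N : Set K) (g : G) (k : K) :
    Subgroup (G × K) :=
  Subgroup.closure ((fun c => ((1 : G), c)) '' N ∪ {(g, k)})

theorem FinGSet.mem_fixed_cyclicOver {G K : Type u} [Group G] [Group K] {X : FinGSet (G × K)}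
    {N : Set K} {g : G} {k : K} {x : X.carrier} :
    x ∈ X.fixed (cyclicOver N g k) ↔
      (∀ c ∈ N, ((1 : G), c) • x = x) ∧ (g, k) • x = x := by
  rw [cyclicOver, FinGSet.mem_fixed_closure]
  constructor
  · exact fun h => ⟨fun c hc => h _ (Or.inl ⟨c, hc, rfl⟩), h _ (Or.inr rfl)⟩
  · rintro h _ (⟨c, hc, rfl⟩ | rfl)
    · exact h.1 c hc
    · exact h.2

/-- A `p`-power of `(g, c)` kills `g`, and a further power recovers `c`, whose order is prime to
`p`. -/
theorem smul_eq_of_isPGroup {p : ℕ} (hp : p.Prime) {G K X : Type*} [Group G] [Group K]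
    [MulAction (G × K) X] (hG : IsPGroup p G) {g : G} {c : K} (hc : ¬ p ∣ orderOf c) {x : X}
    (h : (g, c) • x = x) : ((1 : G), c) • x = x := by
  obtain ⟨m, hm⟩ := hG g
  have h1 : (g, c) ^ p ^ m ∈ MulAction.stabilizer (G × K) x := pow_mem h _
  rw [Prod.pow_mk, hm] at h1
  obtain ⟨j, hj⟩ := exists_pow_eq_self_of_coprime
    (((hp.coprime_iff_not_dvd).mpr hc).pow_left m)
  have h2 := pow_mem h1 j
  rw [Prod.pow_mk, one_pow, hj] at h2
  exact h2

namespace Biset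

variable {G H K : Type u} [Group G] [Group H] [Group K] [Finite K]

/-- Burnside's lemma for `G` acting on `U × X`, whose orbits are the points of the tensor product.
The elements of `N` lift from an orbit to each of its points, since their order is prime to `p`;
only the last generator `(h, k)` may move a point within its orbit. -/
theorem card_fixed_cyclicOver [Finite G] {p : ℕ} (hp : p.Prime) (hG : IsPGroup p G)
    (U : Biset H G) (X : FinGSet (G × K)) {N : Set K} (hN : ∀ c ∈ N, ¬ p ∣ orderOf c)
    (h : H) (k : K) :
    Nat.card (((U.shift K).tensor X).fixed (cyclicOver N h k)) * Nat.card G =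
      Nat.card (Σ g : G, {u : U.carrier // MulOpposite.op g⁻¹ • h • u = u} ×
        X.fixed (cyclicOver N g k)) := by
  classical
  let _ : MulAction G (U.carrier × X.carrier) :=
    { smul := fun g y => (MulOpposite.op g⁻¹ • y.1, (g, (1 : K)) • y.2)
      one_smul := fun y => Prod.ext
        (by show MulOpposite.op (1 : G)⁻¹ • y.1 = y.1; rw [inv_one, MulOpposite.op_one, one_smul])
        (one_smul (G × K) y.2)
      mul_smul := fun a b y => Prod.ext
        (by
          show MulOpposite.op (a * b)⁻¹ • y.1 = MulOpposite.op a⁻¹ • MulOpposite.op b⁻¹ • y.1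
          rw [smul_smul, ← MulOpposite.op_mul, mul_inv_rev])
        (by
          show (a * b, (1 : K)) • y.2 = (a, (1 : K)) • (b, (1 : K)) • y.2
          rw [smul_smul, Prod.mk_mul_mk, mul_one]) }
  have smul_def : ∀ (g : G) (u : U.carrier) (x : X.carrier),
      g • (u, x) = (MulOpposite.op g⁻¹ • u, (g, (1 : K)) • x) := fun _ _ _ => rfl
  let s : U.carrier × X.carrier → U.carrier × X.carrier :=
    fun y => (h • y.1, ((1 : G), k) • y.2)
  have hP : ∀ y : U.carrier × X.carrier,
      U.smk X y.1 y.2 ∈ ((U.shift K).tensor X).fixed (cyclicOver N h k) ↔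
        (∀ c ∈ N, ((1 : G), c) • y.2 = y.2) ∧ ∃ g : G, g • s y = y := by
    rintro ⟨u, x⟩
    rw [FinGSet.mem_fixed_cyclicOver]
    refine and_congr (forall₂_congr fun c hc => ?_) ?_
    · rw [smul_smk, one_smul, smk_eq_smk]
      constructor
      · rintro ⟨g, -, hg⟩
        rw [smul_smul, Prod.mk_mul_mk, mul_one, one_mul] at hg
        exact smul_eq_of_isPGroup hp hG (hN c hc) hg.symm
      · intro hx
        refine ⟨1, ?_, ?_⟩
        · rw [inv_one, MulOpposite.op_one, one_smul]
        · rw [hx]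
          exact (one_smul (G × K) x).symm
    · rw [smul_smk, smk_eq_smk]
      exact exists_congr fun g => by rw [smul_def, Prod.ext_iff, eq_comm, @eq_comm _ x]
  -- The `g` with `g • s y = y` form a coset of the stabilizer of `y`. Translating by one of them,
  -- `γ y`, replaces the pairs counted by Burnside's lemma with pairs whose condition separates into
  -- one on `u` and one on `x`.
  have hex : ∀ y : U.carrier × X.carrier, ∃ g : G,
      U.smk X y.1 y.2 ∈ ((U.shift K).tensor X).fixed (cyclicOver N h k) → g • s y = y := by
    intro y
    by_cases hy : U.smk X y.1 y.2 ∈ ((U.shift K).tensor X).fixed (cyclicOver N h k)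
    · obtain ⟨g, hg⟩ := ((hP y).mp hy).2
      exact ⟨g, fun _ => hg⟩
    · exact ⟨1, fun h => (hy h).elim⟩
  choose γ hγ using hex
  have hcount := card_orbits_mul_card (G := G) (fun y : U.carrier × X.carrier => U.smk X y.1 y.2)
    (fun t => by
      obtain ⟨u, x, rfl⟩ := smk_surjective U X t
      exact ⟨(u, x), rfl⟩)
    (fun y y' => smk_eq_smk.trans (exists_congr fun g =>
      ⟨fun h => Prod.ext h.1.symm h.2.symm,
        fun h => ⟨(congrArg Prod.fst h).symm, (congrArg Prod.snd h).symm⟩⟩))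
    (fun t => t ∈ ((U.shift K).tensor X).fixed (cyclicOver N h k))
  refine hcount.trans ?_
  refine Nat.card_congr (Equiv.trans (β := {z : G × (U.carrier × X.carrier) //
    (∀ c ∈ N, ((1 : G), c) • z.2.2 = z.2.2) ∧ z.1 • s z.2 = z.2}) ?_ ?_)
  · refine ⟨fun z => ⟨(z.1.1 * γ z.1.2, z.1.2), ((hP _).mp z.2.1).1, ?_⟩,
      fun z => ⟨(z.1.1 * (γ z.1.2)⁻¹, z.1.2), (hP _).mpr ⟨z.2.1, _, z.2.2⟩, ?_⟩,
      fun z => Subtype.ext (Prod.ext (mul_inv_cancel_right _ _) rfl),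
      fun z => Subtype.ext (Prod.ext (inv_mul_cancel_right _ _) rfl)⟩
    · show (z.1.1 * γ z.1.2) • s z.1.2 = z.1.2
      rw [mul_smul, hγ _ z.2.1]
      exact z.2.2
    · show (z.1.1 * (γ z.1.2)⁻¹) • z.1.2 = z.1.2
      have h1 := hγ _ ((hP _).mpr ⟨z.2.1, _, z.2.2⟩)
      nth_rewrite 2 [← h1]
      rw [mul_smul, inv_smul_smul]
      exact z.2.2
  · refine ⟨fun z => ⟨z.1.1, ⟨z.1.2.1, congrArg Prod.fst z.2.2⟩, ⟨z.1.2.2, ?_⟩⟩,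
      fun z => ⟨(z.1, z.2.1.1, z.2.2.1), ?_, ?_⟩, fun _ => rfl, fun _ => rfl⟩
    · rw [FinGSet.mem_fixed_cyclicOver]
      refine ⟨z.2.1, ?_⟩
      have h1 : (z.1.1, (1 : K)) • ((1 : G), k) • z.1.2.2 = z.1.2.2 := congrArg Prod.snd z.2.2
      rwa [smul_smul, Prod.mk_mul_mk, mul_one, one_mul] at h1
    · exact (FinGSet.mem_fixed_cyclicOver.mp z.2.2.2).1
    · refine Prod.ext z.2.1.2 ?_
      have h1 := (FinGSet.mem_fixed_cyclicOver.mp z.2.2.2).2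
      show (z.1, (1 : K)) • ((1 : G), k) • z.2.2.1 = z.2.2.1
      rwa [smul_smul, Prod.mk_mul_mk, mul_one, one_mul]

/-- Only `g` varies on the right, with `N` and `k` fixed: the marks at `p`-cyclic subgroups over a
given subgroup of `K` are combinations of marks of the same kind. -/
theorem mark_cyclicOver [Fintype G] {p : ℕ} (hp : p.Prime) (hG : IsPGroup p G)
    (U : Biset H G) (x : FB F (G × K)) {N : Set K} (hN : ∀ c ∈ N, ¬ p ∣ orderOf c)
    (h : H) (k : K) :
    (Nat.card G : F) * FB.mark (cyclicOver N h k) ((U.shift K).map F x) =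
      ∑ g : G, (Nat.card {u : U.carrier // MulOpposite.op g⁻¹ • h • u = u} : F) *
        FB.mark (cyclicOver N g k) x := by
  suffices hs : (Nat.card G : F) • (FB.mark (cyclicOver N h k)).comp ((U.shift K).map F) =
      ∑ g : G, (Nat.card {u : U.carrier // MulOpposite.op g⁻¹ • h • u = u} : F) •
        FB.mark (F := F) (cyclicOver N g k) by
    simpa using DFunLike.congr_fun hs x
  refine FB.hom_ext fun X => ?_
  simp only [LinearMap.smul_apply, LinearMap.comp_apply, LinearMap.sum_apply, FB.map_of,
    FB.mark_of, smul_eq_mul]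
  rw [mul_comm, ← Nat.cast_mul, card_fixed_cyclicOver hp hG U X hN, Nat.card_sigma]
  simp [Nat.card_prod]

end Biset

/-! ## Deflation by a central subgroup of prime order -/

/-- The complements in `L` of a subgroup `Z`. -/
def complements {A : Type u} [Group A] (Z L : Subgroup A) : Set (Subgroup A) :=
  {S | S ⊔ Z = L ∧ S ⊓ Z = ⊥}

theorem exists_mul_of_mem_complements {A : Type u} [Group A] {Z L S : Subgroup A}
    (hZ : Z ≤ Subgroup.center A) (hS : S ∈ complements Z L) {l : A} (hl : l ∈ L) :
    ∃ s ∈ S, ∃ z ∈ Z, s * z = l := by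
  have : Z.Normal := ⟨fun n hn g => by
    rwa [Subgroup.mem_center_iff.mp (hZ hn) g, mul_inv_cancel_right]⟩
  rw [← hS.1] at hl
  exact Subgroup.mem_sup_of_normal_right.mp hl

/-- Burnside's lemma counts pairs `(z, x)` with `z • x = x` such that `L` preserves the `Z`-orbit of
`x`. A point fixed by `L` occurs with every `z`. For any other point `Z` acts freely, since its
order is prime, so only `z = 1` occurs; the stabilizer of the point in `L` is then the unique
complement of `Z` fixing it. -/
theorem FinGSet.card_fixed_central {A : Type u} [Group A] [Finite A] (X : FinGSet A)
    {Z L : Subgroup A} (hZ : Z ≤ Subgroup.center A) (hZL : Z ≤ L) (hp : (Nat.card Z).Prime)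
    {Ω : Type*} (π : X.carrier → Ω) (hπ : Function.Surjective π)
    (hfib : ∀ x y, π x = π y ↔ ∃ z ∈ Z, z • x = y) (P : Ω → Prop)
    (hP : ∀ x, P (π x) ↔ ∀ l ∈ L, ∃ z ∈ Z, z • x = l • x) :
    Nat.card {ω // P ω} * Nat.card Z = Nat.card Z * Nat.card (X.fixed L) +
      Nat.card (Σ S : complements Z L, (X.fixed S.1 \ X.fixed L : Set X.carrier)) := by
  classical
  have hcomm : ∀ z ∈ Z, ∀ a : A, a * z = z * a := fun z hz a =>
    Subgroup.mem_center_iff.mp (hZ hz) a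
  -- A nontrivial element of `Z` generates `Z`; if it fixes `x`, the orbit of `x` under `Z` is a
  -- single point, and `L` fixes it.
  have hgen : ∀ x, P (π x) → ∀ z ∈ Z, z ≠ 1 → z • x = x → x ∈ X.fixed L := by
    intro x hx z hz hz1 hzx l hl
    obtain ⟨z', hz', h⟩ := (hP x).mp hx l hl
    have := Fact.mk hp
    have h1 : (⟨z', hz'⟩ : Z) ∈ Subgroup.zpowers (⟨z, hz⟩ : Z) :=
      mem_zpowers_of_prime_card rfl (fun h => hz1 (congrArg Subtype.val h))
    obtain ⟨n, hn⟩ := h1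
    have h2 : z ^ n = z' := congrArg Subtype.val hn
    rw [← h, ← h2]
    exact (zpow_mem (show z ∈ MulAction.stabilizer A x from hzx) n)
  have hPS : ∀ S ∈ complements Z L, ∀ x ∈ X.fixed S, P (π x) := by
    intro S hS x hx
    rw [hP]
    intro l hl
    obtain ⟨s, hs, z, hz, rfl⟩ := exists_mul_of_mem_complements hZ hS hl
    exact ⟨z, hz, by rw [hcomm z hz, mul_smul, hx s hs]⟩
  rw [card_orbits_mul_card (G := Z) π hπ (fun x y => (hfib x y).trans
    ⟨fun ⟨z, hz, h⟩ => ⟨⟨z, hz⟩, h⟩, fun ⟨z, h⟩ => ⟨z.1, z.2, h⟩⟩), ← Nat.card_prod,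
    ← Nat.card_sum]
  symm
  have hPL : ∀ x ∈ X.fixed L, P (π x) := fun x hx =>
    (hP x).mpr fun l hl => ⟨1, one_mem _, by rw [one_smul, hx l hl]⟩
  refine Nat.card_congr (Equiv.ofBijective (Sum.elim
    (fun w => ⟨(w.1, w.2.1), hPL _ w.2.2, w.2.2 w.1.1 (hZL w.1.2)⟩)
    (fun w => ⟨(1, w.2.1), hPS _ w.1.2 _ w.2.2.1, one_smul A w.2.1⟩)) ⟨?_, ?_⟩)
  · have key : ∀ S ∈ complements Z L, ∀ S' ∈ complements Z L, ∀ x ∈ X.fixed S, x ∈ X.fixed S' →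
        x ∉ X.fixed L → S' ≤ S := by
      intro S hS S' hS' x hx hx' hxL s' hs'
      obtain ⟨s, hs, z, hz, rfl⟩ := exists_mul_of_mem_complements hZ hS
        (hS'.1 ▸ Subgroup.mem_sup_left hs' : s' ∈ L)
      have h1 := hx' _ hs'
      rw [hcomm z hz, mul_smul, hx s hs] at h1
      by_cases hz1 : z = 1
      · rwa [hz1, mul_one]
      · exact (hxL (hgen x (hPS S hS x hx) z hz hz1 h1)).elim
    rintro (⟨z, x⟩ | ⟨S, x⟩) (⟨z', x'⟩ | ⟨S', x'⟩) h
    · have h1 : z = z' := congrArg (fun w => w.1.1) h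
      have h2 : x.1 = x'.1 := congrArg (fun w => w.1.2) h
      exact congrArg Sum.inl (Prod.ext h1 (Subtype.ext h2))
    · have h1 : x.1 = x'.1 := congrArg (fun w => w.1.2) h
      exact (x'.2.2 (h1 ▸ x.2)).elim
    · have h1 : x.1 = x'.1 := congrArg (fun w => w.1.2) h
      exact (x.2.2 (h1 ▸ x'.2)).elim
    · have h1 : x.1 = x'.1 := congrArg (fun w => w.1.2) h
      obtain ⟨x, hx⟩ := x
      obtain ⟨x', hx'⟩ := x'
      dsimp only at h1
      subst h1
      obtain rfl : S = S' := Subtype.ext (le_antisymm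
        (key _ S'.2 _ S.2 x hx'.1 hx.1 hx.2) (key _ S.2 _ S'.2 x hx.1 hx'.1 hx.2))
      rfl
  · rintro ⟨⟨z, x⟩, hx, hzx⟩
    by_cases hxL : x ∈ X.fixed L
    · exact ⟨Sum.inl (z, ⟨x, hxL⟩), rfl⟩
    · have hS : L ⊓ MulAction.stabilizer A x ∈ complements Z L := by
        refine ⟨le_antisymm (sup_le inf_le_left hZL) fun l hl => ?_, ?_⟩
        · obtain ⟨z, hz, h⟩ := (hP x).mp hx l hl
          have h1 : z⁻¹ * l ∈ L ⊓ MulAction.stabilizer A x := by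
            refine Subgroup.mem_inf.mpr ⟨mul_mem (inv_mem (hZL hz)) hl, ?_⟩
            rw [MulAction.mem_stabilizer_iff, mul_smul, ← h, inv_smul_smul]
          have h2 := mul_mem (Subgroup.mem_sup_right hz) (Subgroup.mem_sup_left (T := Z) h1)
          rwa [mul_inv_cancel_left] at h2
        · rw [eq_bot_iff]
          rintro z' ⟨⟨-, h1⟩, h2⟩
          by_contra hz1
          exact hxL (hgen x hx z' h2 hz1 h1)
      refine ⟨Sum.inr ⟨⟨_, hS⟩, ⟨x, fun l hl => hl.2, hxL⟩⟩, ?_⟩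
      refine Subtype.ext (Prod.ext ?_ rfl)
      by_contra hz1
      exact hxL (hgen x hx z.1 z.2 (fun h => hz1 (Subtype.ext h).symm) hzx)

/-- Since `q` is onto, every class has a representative over `1 ∈ H`, so the tensor product is the
set of `Z`-orbits on `X`, and `FinGSet.card_fixed_central` applies. -/
theorem Biset.mark_push {G H K : Type u} [Group G] [Finite G] [Group H] [Finite H] [Group K]
    [Finite K] {q : G →* H} (hq : Function.Surjective q)
    (hZ : (prodId K q).ker ≤ Subgroup.center (G × K))
    (hp : (Nat.card (prodId K q).ker).Prime) (L : Subgroup (H × K)) (x : FB F (G × K)) :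
    (Nat.card (prodId K q).ker : F) * FB.mark L (((push q).shift K).map F x) =
      (Nat.card (prodId K q).ker : F) * FB.mark (L.comap (prodId K q)) x +
        ∑ᶠ S : complements (prodId K q).ker (L.comap (prodId K q)),
          (FB.mark S.1 x - FB.mark (L.comap (prodId K q)) x) := by
  classical
  set Z := (prodId K q).ker with hZdef
  set M := L.comap (prodId K q) with hM
  have hZM : Z ≤ M := Subgroup.ker_le_comap _ _
  let _ := Fintype.ofFinite (complements Z M)
  rw [finsum_eq_sum_of_fintype]
  suffices hs : (Nat.card Z : F) • (FB.mark L).comp (((push q).shift K).map F) =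
      (Nat.card Z : F) • FB.mark (F := F) M +
        ∑ S : complements Z M, (FB.mark S.1 - FB.mark M) by
    simpa using DFunLike.congr_fun hs x
  refine FB.hom_ext fun X => ?_
  simp only [LinearMap.smul_apply, LinearMap.comp_apply, LinearMap.sum_apply, FB.map_of,
    FB.mark_of, smul_eq_mul, LinearMap.add_apply, LinearMap.sub_apply]
  let one : (push q).carrier := (1 : H)
  have hmem : ∀ g : G, (g, (1 : K)) ∈ Z ↔ q g = 1 := by
    intro g
    rw [hZdef, MonoidHom.mem_ker]
    exact ⟨fun h => congrArg Prod.fst h, fun h => Prod.ext h rfl⟩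
  have hone : ∀ z ∈ Z, z = (z.1, (1 : K)) := fun z hz => by
    have h : (prodId K q z).2 = 1 := congrArg Prod.snd (MonoidHom.mem_ker.mp hz)
    exact Prod.ext rfl h
  have hact : ∀ (g : G) (k : K) (y : X.carrier),
      (q g, k) • (push q).smk X one y = (push q).smk X one ((g, k) • y) := by
    intro g k y
    rw [smul_smk, smk_eq_smk]
    refine ⟨g, ?_, ?_⟩
    · show (1 : H) = q g * 1 * q g⁻¹
      rw [mul_one, map_inv, mul_inv_cancel]
    · rw [smul_smul, Prod.mk_mul_mk, mul_one, one_mul]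
  have hfib : ∀ y y' : X.carrier, (push q).smk X one y = (push q).smk X one y' ↔
      ∃ z ∈ Z, z • y = y' := by
    intro y y'
    rw [smk_eq_smk]
    constructor
    · rintro ⟨g, h1, h2⟩
      have h1 : (1 : H) = 1 * q g⁻¹ := h1
      rw [one_mul, map_inv, eq_comm, inv_eq_one] at h1
      exact ⟨(g, 1), (hmem g).mpr h1, h2.symm⟩
    · rintro ⟨⟨g, k⟩, hz, h⟩
      obtain rfl : k = 1 := congrArg Prod.snd (hone _ hz)
      refine ⟨g, ?_, h.symm⟩
      show (1 : H) = 1 * q g⁻¹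
      rw [map_inv, (hmem _).mp hz, inv_one, mul_one]
  have h := X.card_fixed_central hZ hZM hp (fun y => (push q).smk X one y) (fun t => by
      obtain ⟨u, y, rfl⟩ := smk_surjective _ _ t
      let u' : H := u
      obtain ⟨g, hg⟩ := hq u'
      refine ⟨(g, 1) • y, (smk_eq_smk.mpr ⟨g, ?_, rfl⟩).symm⟩
      show (1 : H) = u' * q g⁻¹
      rw [map_inv]
      exact (mul_inv_eq_one.mpr hg.symm).symm) hfib
    (fun t => t ∈ (((push q).shift K).tensor X).fixed L) (fun y => by
      rw [FinGSet.mem_fixed]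
      constructor
      · rintro h ⟨g, k⟩ hl
        exact (hfib _ _).mp (by rw [← hact]; exact (h (q g, k) hl).symm)
      · rintro h ⟨g', k⟩ hl
        obtain ⟨g, rfl⟩ := hq g'
        rw [hact]
        exact ((hfib _ _).mpr (h (g, k) hl)).symm)
  rw [mul_comm, ← Nat.cast_mul, ← Nat.cast_mul]
  refine (congrArg (Nat.cast (R := F)) h).trans ?_
  rw [Nat.cast_add, Nat.card_sigma, Nat.cast_sum]
  congr 1
  refine Finset.sum_congr rfl fun S _ => ?_
  have hsub : X.fixed M ⊆ X.fixed S.1 := fun y hy s hs =>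
    hy s (S.2.1 ▸ Subgroup.mem_sup_left hs)
  have h2 := Set.ncard_sdiff_add_ncard_of_subset hsub
  rw [eq_sub_iff_add_eq, ← Nat.cast_add]
  exact congrArg Nat.cast h2

/-! ## Groups with cyclic largest `p`-quotient -/

/-- The quotient `L / O^p(L)` is cyclic. -/
def IsPCyclic (p : ℕ) (L : Type u) [Group L] : Prop := IsCyclic (L ⧸ pResidual p L)

/-- Generation by the elements of order prime to `p` and one more passes directly to images and
lifts to explicit generators. -/
theorem isPCyclic_iff {p : ℕ} {L : Type u} [Group L] :
    IsPCyclic p L ↔ ∃ a : L, Subgroup.closure ({y : L | ¬ p ∣ orderOf y} ∪ {a}) = ⊤ := by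
  constructor
  · intro h
    obtain ⟨b, hb⟩ := h.exists_generator
    obtain ⟨a, rfl⟩ := QuotientGroup.mk_surjective b
    refine ⟨a, eq_top_iff.mpr fun x _ => ?_⟩
    obtain ⟨n, hn⟩ := hb (x : L ⧸ pResidual p L)
    have h1 : (a ^ n)⁻¹ * x ∈ pResidual p L := QuotientGroup.eq.mp hn
    have h0 : a ∈ Subgroup.closure ({y : L | ¬ p ∣ orderOf y} ∪ {a}) :=
      Subgroup.subset_closure (Or.inr rfl)
    have h2 := zpow_mem h0 n
    have h3 := mul_mem h2 (Subgroup.closure_mono Set.subset_union_left h1)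
    rwa [mul_inv_cancel_left] at h3
  · rintro ⟨a, ha⟩
    show IsCyclic (L ⧸ pResidual p L)
    refine ⟨⟨QuotientGroup.mk a, fun b => ?_⟩⟩
    obtain ⟨x, rfl⟩ := QuotientGroup.mk_surjective b
    have hle : Subgroup.closure ({y : L | ¬ p ∣ orderOf y} ∪ {a}) ≤
        (Subgroup.zpowers (a : L ⧸ pResidual p L)).comap (QuotientGroup.mk' _) := by
      rw [Subgroup.closure_le]
      rintro y (hy | rfl)
      · have h1 : (y : L ⧸ pResidual p L) = 1 :=
          (QuotientGroup.eq_one_iff y).mpr (Subgroup.subset_closure hy)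
        exact ⟨0, by simpa using h1.symm⟩
      · exact Subgroup.mem_zpowers _
    exact hle (ha ▸ Subgroup.mem_top x)

theorem IsPCyclic.of_surjective {p : ℕ} {L M : Type u} [Group L] [Group M] (h : IsPCyclic p L)
    (f : L →* M) (hf : Function.Surjective f) : IsPCyclic p M := by
  obtain ⟨a, ha⟩ := isPCyclic_iff.mp h
  refine isPCyclic_iff.mpr ⟨f a, eq_top_iff.mpr ?_⟩
  rw [← Subgroup.map_top_of_surjective f hf, ← ha, MonoidHom.map_closure]
  refine Subgroup.closure_mono ?_
  rintro _ ⟨y, hy | rfl, rfl⟩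
  · exact Or.inl fun h1 => hy (h1.trans (orderOf_map_dvd f y))
  · exact Or.inr rfl

theorem IsPCyclic.map {p : ℕ} {A B : Type u} [Group A] [Group B] {L : Subgroup A}
    (h : IsPCyclic p L) (f : A →* B) : IsPCyclic p (L.map f) :=
  h.of_surjective (f.subgroupMap L) (f.subgroupMap_surjective L)

theorem isPCyclic_congr {p : ℕ} {L M : Type u} [Group L] [Group M] (e : L ≃* M) :
    IsPCyclic p L ↔ IsPCyclic p M :=
  ⟨fun h => h.of_surjective e.toMonoidHom e.surjective,
    fun h => h.of_surjective e.symm.toMonoidHom e.symm.surjective⟩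

theorem isPCyclic_of_class {p : ℕ} {A : Type u} [Group A] {L M : Subgroup A}
    (h : subgroupClass L = subgroupClass M) : IsPCyclic p L ↔ IsPCyclic p M := by
  obtain ⟨g, rfl⟩ := subgroupClass_eq_iff.mp h
  exact isPCyclic_congr (Subgroup.equivSMul g M).symm

theorem isPCyclic_cyclicOver {p : ℕ} {G K : Type u} [Group G] [Group K] {N : Set K}
    (hN : ∀ c ∈ N, ¬ p ∣ orderOf c) (g : G) (k : K) : IsPCyclic p (cyclicOver N g k) := by
  rw [isPCyclic_iff]
  refine ⟨⟨(g, k), Subgroup.subset_closure (Or.inr rfl)⟩, eq_top_iff.mpr ?_⟩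
  refine Subgroup.closure_closure_coe_preimage.symm.le.trans (Subgroup.closure_mono ?_)
  rintro ⟨y, hy'⟩ (⟨c, hc, h⟩ | h)
  · left
    have h : ((1 : G), c) = y := h
    subst h
    have h1 : orderOf (⟨((1 : G), c), hy'⟩ : cyclicOver N g k) = orderOf ((1 : G), c) :=
      (Subgroup.orderOf_coe (⟨((1 : G), c), hy'⟩ : cyclicOver N g k)).symm
    show ¬ p ∣ orderOf (⟨((1 : G), c), hy'⟩ : cyclicOver N g k)
    rw [h1, Prod.orderOf_mk, orderOf_one, Nat.lcm_one_left]
    exact hN c hc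
  · exact Or.inr (Subtype.ext h)

/-- As `G` is a `p`-group, an element of `G × K` of order prime to `p` has trivial first component;
hence a single generator with a component in `G` suffices. -/
theorem IsPCyclic.exists_eq_cyclicOver {p : ℕ} (hp : p.Prime) {G K : Type u} [Group G] [Group K]
    (hG : IsPGroup p G) {L : Subgroup (G × K)} (h : IsPCyclic p L) :
    ∃ (N : Set K) (g : G) (k : K), (∀ c ∈ N, ¬ p ∣ orderOf c) ∧ L = cyclicOver N g k := by
  obtain ⟨⟨⟨g, k⟩, ha⟩, h1⟩ := isPCyclic_iff.mp h
  refine ⟨{c | ((1 : G), c) ∈ L ∧ ¬ p ∣ orderOf c}, g, k, fun c hc => hc.2, le_antisymm ?_ ?_⟩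
  · have h2 := congrArg (Subgroup.map L.subtype) h1
    rw [MonoidHom.map_closure, ← MonoidHom.range_eq_map, Subgroup.range_subtype] at h2
    refine h2.symm.le.trans (Subgroup.closure_mono ?_)
    rintro _ ⟨⟨⟨g', k'⟩, hy'⟩, hy | hy, rfl⟩
    · left
      have h3 : ¬ p ∣ orderOf (g', k') := fun h => hy (by rwa [← Subgroup.orderOf_coe])
      rw [Prod.orderOf_mk] at h3
      have h4 : g' = 1 := by
        have := Fact.mk hp
        by_contra hne
        exact h3 ((hG.dvd_orderOf hne).trans (Nat.dvd_lcm_left _ _))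
      subst h4
      exact ⟨k', ⟨hy', fun h => h3 (h.trans (Nat.dvd_lcm_right _ _))⟩, rfl⟩
    · exact Or.inr (congrArg Subtype.val hy)
  · rw [cyclicOver, Subgroup.closure_le]
    rintro _ (⟨c, hc, rfl⟩ | rfl)
    · exact hc.1
    · exact ha

theorem map_snd_cyclicOver {G K : Type u} [Group G] [Group K] (N : Set K) (g : G) (k : K) :
    (cyclicOver N g k).map (MonoidHom.snd G K) = Subgroup.closure (N ∪ {k}) := by
  rw [cyclicOver, MonoidHom.map_closure, Set.image_union, Set.image_image, Set.image_singleton]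
  simp

/-! ### Homomorphisms to a group of order `p`, and counting complements -/

theorem isPGroup_quotient_pResidual {p : ℕ} (hp : p.Prime) (S : Type u) [Group S] [Finite S] :
    IsPGroup p (S ⧸ pResidual p S) := by
  intro x
  obtain ⟨x, rfl⟩ := QuotientGroup.mk_surjective x
  obtain ⟨a, m, hm, h⟩ :=
    Nat.exists_eq_pow_mul_and_not_dvd (orderOf_pos x).ne' p hp.ne_one
  refine ⟨a, ?_⟩
  rw [← QuotientGroup.mk_pow, QuotientGroup.eq_one_iff]
  refine Subgroup.subset_closure ?_
  show ¬ p ∣ orderOf (x ^ p ^ a)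
  rwa [orderOf_pow_of_dvd (pow_ne_zero _ hp.ne_zero) ⟨m, h⟩, h,
    Nat.mul_div_cancel_left _ (pow_pos hp.pos a)]

/-- A proper subgroup of a finite `p`-group lies in the kernel of a surjection to any group of
order `p`. -/
theorem exists_hom_of_ne_top {p : ℕ} [Fact p.Prime] {P Z : Type*} [Group P] [Finite P]
    [Group Z] (hP : IsPGroup p P) (hZ : Nat.card Z = p) {D : Subgroup P} (hD : D ≠ ⊤) :
    ∃ ψ : P →* Z, Function.Surjective ψ ∧ ∀ d ∈ D, ψ d = 1 := by
  obtain ⟨M, hM, hDM⟩ := (eq_top_or_exists_le_coatom D).resolve_left hD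
  have := hP.isNilpotent
  have hN : M.Normal :=
    Subgroup.NormalizerCondition.normal_of_coatom M Group.normalizerCondition_of_isNilpotent hM
  have hnt : Nontrivial (P ⧸ M) := QuotientGroup.nontrivial_iff.mpr hM.1
  have hdvd : p ∣ Nat.card (P ⧸ M) := by
    rcases (hP.to_quotient M).card_eq_or_dvd with h | h
    · exact absurd h Finite.one_lt_card.ne'
    · exact h
  obtain ⟨b, hb⟩ := exists_prime_orderOf_dvd_card' p hdvd
  -- The preimage of `⟨b⟩` strictly contains the maximal subgroup `M`, so it is everything and `P /
  -- M` has order `p`.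
  have htop : Subgroup.zpowers b = ⊤ := by
    have h1 : (Subgroup.zpowers b).comap (QuotientGroup.mk' M) = ⊤ := by
      refine hM.2 _ (lt_of_le_of_ne ?_ fun h => ?_)
      · intro m hm
        have : (m : P ⧸ M) = 1 := (QuotientGroup.eq_one_iff m).mpr hm
        exact Subgroup.mem_comap.mpr (by rw [QuotientGroup.mk'_apply, this]; exact one_mem _)
      · obtain ⟨y, rfl⟩ := QuotientGroup.mk_surjective b
        have hy : y ∈ (Subgroup.zpowers (y : P ⧸ M)).comap (QuotientGroup.mk' M) :=
          Subgroup.mem_zpowers _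
        rw [← h] at hy
        rw [(QuotientGroup.eq_one_iff y).mpr hy, orderOf_one] at hb
        exact (Fact.out : p.Prime).one_lt.ne hb
    refine eq_top_iff.mpr fun x _ => ?_
    obtain ⟨y, rfl⟩ := QuotientGroup.mk_surjective x
    exact (h1 ▸ Subgroup.mem_top y : y ∈ (Subgroup.zpowers b).comap (QuotientGroup.mk' M))
  have hcard : Nat.card (P ⧸ M) = p := by
    rw [← hb, ← Nat.card_zpowers, htop, Subgroup.card_top]
  let e : P ⧸ M ≃* Z := mulEquivOfPrimeCardEq hcard hZ
  refine ⟨e.toMonoidHom.comp (QuotientGroup.mk' M),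
    e.surjective.comp (QuotientGroup.mk'_surjective M), fun d hd => ?_⟩
  have : (d : P ⧸ M) = 1 := (QuotientGroup.eq_one_iff d).mpr (hDM hd)
  show e (d : P ⧸ M) = 1
  rw [this, map_one]

/-- Take `φ a ≠ 1`. If `O^p(S)` and `a` did not generate `S`, some nontrivial `ψ` would kill both;
but `φ` is a power of `ψ`, the group of homomorphisms having prime order, so `φ a = 1`. -/
theorem isPCyclic_of_card_hom {p : ℕ} [hp : Fact p.Prime] {S : Type u} {Z : Type*} [Group S]
    [Finite S] [CommGroup Z] (hZ : Nat.card Z = p) (h : Nat.card (S →* Z) = p) :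
    IsPCyclic p S := by
  have : Finite (S →* Z) := Nat.finite_of_card_ne_zero (h ▸ hp.out.ne_zero)
  have : Finite Z := Nat.finite_of_card_ne_zero (hZ ▸ hp.out.ne_zero)
  have : Nontrivial Z := Finite.one_lt_card_iff_nontrivial.mp (hZ ▸ hp.out.one_lt)
  have : Nontrivial (S →* Z) := Finite.one_lt_card_iff_nontrivial.mp (h ▸ hp.out.one_lt)
  obtain ⟨φ, hφ⟩ := exists_ne (1 : S →* Z)
  obtain ⟨a, ha⟩ := DFunLike.ne_iff.mp hφ
  refine isPCyclic_iff.mpr ⟨a, ?_⟩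
  by_contra htop
  set D := Subgroup.closure ({y : S | ¬ p ∣ orderOf y} ∪ {a}) with hD
  have hO : pResidual p S ≤ D := Subgroup.closure_mono Set.subset_union_left
  have hne : D.map (QuotientGroup.mk' (pResidual p S)) ≠ ⊤ := by
    intro h1
    have h2 := congrArg (Subgroup.comap (QuotientGroup.mk' (pResidual p S))) h1
    rw [QuotientGroup.comap_map_mk', Subgroup.comap_top, sup_eq_right.mpr hO] at h2
    exact htop h2
  obtain ⟨ψ, hψ, hψD⟩ := exists_hom_of_ne_top (isPGroup_quotient_pResidual hp.out S) hZ hne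
  have hψ1 : ψ.comp (QuotientGroup.mk' (pResidual p S)) ≠ 1 := by
    intro h1
    obtain ⟨z, hz⟩ := exists_ne (1 : Z)
    obtain ⟨x, rfl⟩ := (hψ.comp (QuotientGroup.mk'_surjective _)) z
    exact hz (DFunLike.congr_fun h1 x)
  obtain ⟨j, hj⟩ := mem_zpowers_of_prime_card h hψ1 (g' := φ)
  refine ha ?_
  rw [← hj]
  show (ψ.comp (QuotientGroup.mk' (pResidual p S)) ^ j) a = 1
  have h2 : ψ (QuotientGroup.mk' (pResidual p S) a) = 1 :=
    hψD _ ⟨a, Subgroup.subset_closure (Or.inr rfl), rfl⟩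
  rw [MonoidHom.zpow_apply, MonoidHom.comp_apply, h2, one_zpow]

/-- The complements of a central subgroup `Z` are the graphs of the homomorphisms from one of
them to `Z`. -/
theorem card_complements {A : Type u} [Group A] {Z L S : Subgroup A}
    (hZ : Z ≤ Subgroup.center A) (hS : S ∈ complements Z L) :
    Nat.card (complements Z L) = Nat.card (S →* Z) := by
  have hcomm : ∀ z ∈ Z, ∀ a : A, a * z = z * a := fun z hz a =>
    Subgroup.mem_center_iff.mp (hZ hz) a
  have huniq : ∀ T : Subgroup A, T ∈ complements Z L → ∀ a, ∀ z ∈ Z, ∀ z' ∈ Z,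
      a * z ∈ T → a * z' ∈ T → z = z' := by
    intro T hT a z hz z' hz' h h'
    have h1 : z⁻¹ * z' ∈ T ⊓ Z := by
      refine Subgroup.mem_inf.mpr ⟨?_, mul_mem (inv_mem hz) hz'⟩
      have := mul_mem (inv_mem h) h'
      rwa [mul_inv_rev, mul_assoc, inv_mul_cancel_left] at this
    rw [hT.2, Subgroup.mem_bot] at h1
    exact inv_mul_eq_one.mp h1
  let gr (φ : S →* Z) : S →* A :=
    { toFun := fun s => s.1 * (φ s).1
      map_one' := by simp
      map_mul' := fun s t => by
        rw [map_mul, Subgroup.coe_mul, Subgroup.coe_mul, mul_assoc, mul_assoc,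
          ← mul_assoc t.1, hcomm _ (φ s).2 t.1, mul_assoc] }
  symm
  refine Nat.card_congr (Equiv.ofBijective (fun φ => ⟨(gr φ).range, ?_, ?_⟩) ⟨?_, ?_⟩)
  · rw [← hS.1]
    refine le_antisymm (sup_le ?_ le_sup_right) (sup_le ?_ le_sup_right)
    · rintro _ ⟨s, rfl⟩
      exact mul_mem (Subgroup.mem_sup_left s.2) (Subgroup.mem_sup_right (φ s).2)
    · intro s hs
      have h0 : gr φ ⟨s, hs⟩ ∈ (gr φ).range := ⟨⟨s, hs⟩, rfl⟩
      have h1 : gr φ ⟨s, hs⟩ * (φ ⟨s, hs⟩ : A)⁻¹ ∈ (gr φ).range ⊔ Z :=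
        mul_mem (Subgroup.mem_sup_left h0) (Subgroup.mem_sup_right (inv_mem (φ ⟨s, hs⟩).2))
      have h2 : gr φ ⟨s, hs⟩ * (φ ⟨s, hs⟩ : A)⁻¹ = s := mul_inv_cancel_right _ _
      rwa [h2] at h1
  · rw [eq_bot_iff]
    rintro _ ⟨⟨s, rfl⟩, h⟩
    have h1 : s.1 * (φ s).1 ∈ Z := h
    have h2 : s.1 ∈ S ⊓ Z := ⟨s.2, (Subgroup.mul_mem_cancel_right Z (φ s).2).mp h1⟩
    rw [hS.2, Subgroup.mem_bot] at h2
    obtain rfl : s = 1 := Subtype.ext h2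
    rw [map_one]
    exact one_mem _
  · intro φ ψ h
    have h1 : (gr φ).range = (gr ψ).range := congrArg Subtype.val h
    ext s
    obtain ⟨t, ht⟩ : gr φ s ∈ (gr ψ).range := h1 ▸ ⟨s, rfl⟩
    have h2 : t.1 * (ψ t).1 = s.1 * (φ s).1 := ht
    have h3 : s.1⁻¹ * t.1 = (φ s).1 * (ψ t).1⁻¹ := by
      rw [inv_mul_eq_iff_eq_mul, ← mul_assoc, ← h2, mul_inv_cancel_right]
    have h4 : s.1⁻¹ * t.1 ∈ S ⊓ Z :=
      Subgroup.mem_inf.mpr ⟨mul_mem (inv_mem s.2) t.2, h3 ▸ mul_mem (φ s).2 (inv_mem (ψ t).2)⟩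
    rw [hS.2, Subgroup.mem_bot, inv_mul_eq_one] at h4
    obtain rfl : s = t := Subtype.ext h4
    exact (mul_left_cancel h2).symm
  · rintro ⟨T, hT⟩
    have hex : ∀ s : S, ∃ z : Z, s.1 * z.1 ∈ T := by
      intro s
      obtain ⟨t, ht, z, hz, h⟩ := exists_mul_of_mem_complements hZ hT
        (hS.1 ▸ Subgroup.mem_sup_left s.2 : s.1 ∈ L)
      refine ⟨⟨z⁻¹, inv_mem hz⟩, ?_⟩
      rw [← h, mul_inv_cancel_right]
      exact ht
    choose φ hφ using hex
    let Φ : S →* Z :=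
      { toFun := φ
        map_one' := Subtype.ext (huniq T hT 1 _ (φ 1).2 1 (one_mem _) (hφ 1) (by
          rw [one_mul]
          exact one_mem _))
        map_mul' := fun s t => Subtype.ext (huniq T hT (s.1 * t.1) _ (φ (s * t)).2 _
          (φ s * φ t).2 (hφ (s * t)) (by
            have := mul_mem (hφ s) (hφ t)
            rw [Subgroup.coe_mul, mul_assoc, ← mul_assoc t.1, hcomm _ (φ s).2 t.1]
            rwa [mul_assoc, ← mul_assoc _ t.1] at this)) }
    refine ⟨Φ, Subtype.ext (le_antisymm ?_ ?_)⟩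
    · rintro _ ⟨s, rfl⟩
      exact hφ s
    · intro t ht
      obtain ⟨s, hs, z, hz, h⟩ := exists_mul_of_mem_complements hZ hS
        (hT.1 ▸ Subgroup.mem_sup_left ht : t ∈ L)
      refine ⟨⟨s, hs⟩, ?_⟩
      show s * (φ ⟨s, hs⟩).1 = t
      rw [huniq T hT s _ (φ ⟨s, hs⟩).2 z hz (hφ ⟨s, hs⟩) (h ▸ ht), h]

theorem isPCyclic_of_card_complements {p : ℕ} (hp : p.Prime) {A : Type u} [Group A] [Finite A]
    {Z L : Subgroup A} (hZ : Z ≤ Subgroup.center A) (hZp : Nat.card Z = p)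
    (h : Nat.card (complements Z L) = p) : ∃ S ∈ complements Z L, IsPCyclic p S := by
  have := Fact.mk hp
  have : Nonempty (complements Z L) := (Nat.card_ne_zero.mp (h ▸ hp.ne_zero)).1
  obtain ⟨S, hS⟩ := this
  refine ⟨S, hS, ?_⟩
  let _ : CommGroup Z :=
    { (inferInstance : Group Z) with
      mul_comm := fun a b => Subtype.ext (Subgroup.mem_center_iff.mp (hZ b.2) a.1) }
  exact isPCyclic_of_card_hom hZp ((card_complements hZ hS).symm.trans h)

/-! ## Ideals are determined by marks -/

theorem subgroupClass_map {A B : Type u} [Group A] [Group B] {L M : Subgroup A}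
    (h : subgroupClass L = subgroupClass M) (f : A →* B) :
    subgroupClass (L.map f) = subgroupClass (M.map f) := by
  obtain ⟨g, rfl⟩ := subgroupClass_eq_iff.mp h
  refine subgroupClass_eq_iff.mpr ⟨ConjAct.toConjAct (f (ConjAct.ofConjAct g)), ?_⟩
  ext b
  simp only [Subgroup.mem_smul_pointwise_iff_exists, Subgroup.mem_map, ConjAct.smul_def,
    ConjAct.ofConjAct_toConjAct]
  constructor
  · rintro ⟨_, ⟨a, ha, rfl⟩, rfl⟩
    exact ⟨_, ⟨a, ha, rfl⟩, by simp⟩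
  · rintro ⟨_, ⟨a, ha, rfl⟩, rfl⟩
    exact ⟨_, ⟨a, ha, rfl⟩, by simp⟩

section

variable [CharZero F]

open Classical in
/-- The primitive idempotent of `𝔽B(A)` attached to a subgroup. -/
def FB.idem (F : Type v) [Field F] [CharZero F] {A : Type u} [Group A] [Finite A]
    (L : Subgroup A) : FB F A :=
  (FB.exists_mark_eq (F := F) fun c => if c = subgroupClass L then 1 else 0).choose

open Classical in
theorem FB.mark_idem {A : Type u} [Group A] [Finite A] (L M : Subgroup A) :
    FB.mark M (FB.idem F L) = if subgroupClass M = subgroupClass L then 1 else 0 :=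
  (FB.exists_mark_eq (F := F) fun c => if c = subgroupClass L then 1 else 0).choose_spec M

theorem FB.eq_sum_idem {A : Type u} [Group A] [Finite A] [Fintype (SubgroupClass A)]
    (x : FB F A) : x = ∑ c : SubgroupClass A, FB.mark c.out x • FB.idem F c.out := by
  classical
  refine FB.ext_mark fun L => ?_
  rw [map_sum, Finset.sum_eq_single (subgroupClass L)]
  · rw [map_smul, FB.mark_idem, if_pos (subgroupClass_out _).symm, smul_eq_mul, mul_one]
    exact FB.mark_eq_of_class (subgroupClass_out _).symm _
  · intro c _ hc
    rw [map_smul, FB.mark_idem, if_neg, smul_zero]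
    rw [subgroupClass_out]
    exact hc.symm
  · simp

end

namespace GreenIdeal

variable {p : ℕ} {K : Type u} [Group K] [Finite K]

/-- Some element of the ideal has a nonzero mark at `L`. -/
def Supp (I : GreenIdeal F p K) {G : Type u} [Group G] [Finite G] (hG : IsPGroup p G)
    (L : Subgroup (G × K)) : Prop :=
  ∃ x ∈ I.carrier G hG, FB.mark L x ≠ 0

variable {I J : GreenIdeal F p K} {G H : Type u} [Group G] [Finite G] [Group H] [Finite H]
  {hG : IsPGroup p G} {hH : IsPGroup p H}

theorem Supp.of_class {L M : Subgroup (G × K)} (h : I.Supp hG L)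
    (hLM : subgroupClass L = subgroupClass M) : I.Supp hG M := by
  obtain ⟨x, hx, hne⟩ := h
  exact ⟨x, hx, by rwa [← FB.mark_eq_of_class hLM]⟩

theorem Supp.pull {T : Subgroup (H × K)} (f : H →* G) (h : I.Supp hG (T.map (prodId K f))) :
    I.Supp hH T := by
  obtain ⟨x, hx, hne⟩ := h
  exact ⟨_, I.map_mem _ _ hG hH (Biset.pull f) x hx, by rwa [Biset.mark_pull]⟩

variable [CharZero F]

/-- The pointwise product is the product of the Green functor restricted along the diagonal of `G`.
-/
theorem mul_mem (I : GreenIdeal F p K) (a : FB F (G × K)) {b : FB F (G × K)}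
    (hb : b ∈ I.carrier G hG) : FB.mul a b ∈ I.carrier G hG := by
  have h := I.map_mem _ _ _ hG (Biset.pull ((MonoidHom.id G).prod (MonoidHom.id G))) _
    (I.prod_mem_left G G hG hG a b hb)
  convert h using 1
  refine FB.ext_mark fun L => ?_
  rw [FB.mark_mul, Biset.mark_pull, mark_shiftProd, Subgroup.map_map, Subgroup.map_map]
  have h1 : (prodId K (MonoidHom.fst G G)).comp
      (prodId K ((MonoidHom.id G).prod (MonoidHom.id G))) = MonoidHom.id _ := rfl
  have h2 : (prodId K (MonoidHom.snd G G)).comp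
      (prodId K ((MonoidHom.id G).prod (MonoidHom.id G))) = MonoidHom.id _ := rfl
  rw [h1, h2, Subgroup.map_id]

/-- Multiplying by the idempotent isolates one mark of an element, which is then inverted. -/
theorem supp_iff {L : Subgroup (G × K)} : I.Supp hG L ↔ FB.idem F L ∈ I.carrier G hG := by
  classical
  constructor
  · rintro ⟨x, hx, hne⟩
    have h := (I.carrier G hG).smul_mem (FB.mark L x)⁻¹ (I.mul_mem (FB.idem F L) hx)
    convert h using 1
    refine FB.ext_mark fun M => ?_
    rw [map_smul, FB.mark_mul, FB.mark_idem]
    split_ifs with hM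
    · rw [FB.mark_eq_of_class hM, one_mul, smul_eq_mul, inv_mul_cancel₀ hne]
    · rw [zero_mul, smul_zero]
  · exact fun h => ⟨_, h, by rw [FB.mark_idem, if_pos rfl]; exact one_ne_zero⟩

theorem mem_iff {x : FB F (G × K)} :
    x ∈ I.carrier G hG ↔ ∀ L, FB.mark L x ≠ 0 → I.Supp hG L := by
  refine ⟨fun h L hL => ⟨x, h, hL⟩, fun h => ?_⟩
  let _ := Fintype.ofFinite (SubgroupClass (G × K))
  rw [FB.eq_sum_idem x]
  refine Submodule.sum_mem _ fun c _ => ?_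
  by_cases hc : FB.mark c.out x = 0
  · rw [hc, zero_smul]
    exact zero_mem _
  · exact Submodule.smul_mem _ _ (supp_iff.mp (h _ hc))

/-! ### Transfer of the support between subgroups with the same projection to `K` -/

/-- The conjugacy class of the projection to `K` of a subgroup of `G × K`. -/
def _root_.RelativeBGroups.sndClass {G K : Type u} [Group G] [Group K] (L : Subgroup (G × K)) :
    SubgroupClass K :=
  subgroupClass (L.map (MonoidHom.snd G K))

/-- The one-point biset averages the marks over `g`. Applied to an idempotent, the average is a
positive count divided by `|G|`, nonzero in characteristic `0`; this moves the support to `1 × S`,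
with `S` the projection of `L`. Restriction along the trivial homomorphism then reaches all of `M`.
-/
theorem Supp.of_isPCyclic (hp : p.Prime) {L : Subgroup (G × K)} (h : I.Supp hG L)
    (hL : IsPCyclic p L) {M : Subgroup (H × K)} (hM : sndClass M = sndClass L) :
    I.Supp hH M := by
  classical
  obtain ⟨N, g₀, k, hN, rfl⟩ := hL.exists_eq_cyclicOver hp hG
  let _ := Fintype.ofFinite G
  have h1 : I.Supp hG (cyclicOver N (1 : G) k) := by
    refine ⟨_, I.map_mem _ _ hG hG (Biset.point G G) _ (supp_iff.mp h), fun h0 => ?_⟩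
    have h2 := Biset.mark_cyclicOver hp hG (Biset.point G G)
      (FB.idem F (cyclicOver N g₀ k)) hN 1 k
    rw [h0, mul_zero] at h2
    have hcard : ∀ g : G, Nat.card {u : (Biset.point G G).carrier //
        MulOpposite.op g⁻¹ • (1 : G) • u = u} = 1 := by
      intro g
      have h3 : ∀ u : PUnit.{u + 1}, ∀ v, u = v := fun _ _ => rfl
      exact Nat.card_eq_one_iff_unique.mpr ⟨⟨fun a b => Subtype.ext (h3 _ _)⟩,
        ⟨⟨PUnit.unit, h3 _ _⟩⟩⟩
    simp only [hcard, Nat.cast_one, one_mul, FB.mark_idem] at h2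
    rw [Finset.sum_boole, eq_comm, Nat.cast_eq_zero, Finset.card_eq_zero] at h2
    have h4 : g₀ ∈ (Finset.univ.filter fun g : G =>
      subgroupClass (cyclicOver N g k) = subgroupClass (cyclicOver N g₀ k)) := by simp
    rw [h2] at h4
    simp at h4
  refine Supp.pull (hG := hG) (1 : H →* G) (h1.of_class ?_)
  have h5 : prodId K (1 : H →* G) = (MonoidHom.inr G K).comp (MonoidHom.snd H K) := rfl
  have h6 : cyclicOver N (1 : G) k =
      ((cyclicOver N g₀ k).map (MonoidHom.snd G K)).map (MonoidHom.inr G K) := by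
    rw [map_snd_cyclicOver, MonoidHom.map_closure, Set.image_union, Set.image_singleton]
    rfl
  rw [h5, ← Subgroup.map_map, h6]
  exact subgroupClass_map hM.symm _

theorem Supp.push_central (hp : p.Prime) {q : G →* H} (hq : Function.Surjective q)
    (hZ : (prodId K q).ker ≤ Subgroup.center (G × K))
    (hZp : Nat.card (prodId K q).ker = p) {T : Subgroup (G × K)} (h : I.Supp hG T)
    (hT : ¬ IsPCyclic p (T.map (prodId K q))) : I.Supp hH (T.map (prodId K q)) := by
  classical
  refine ⟨_, I.map_mem _ _ hG hH (Biset.push q) _ (supp_iff.mp h), fun h0 => ?_⟩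
  have h1 := Biset.mark_push hq hZ (hZp ▸ hp) (T.map (prodId K q)) (FB.idem F T)
  rw [h0, mul_zero, hZp] at h1
  set Z := (prodId K q).ker with hZdef
  set M := (T.map (prodId K q)).comap (prodId K q) with hM
  have hMT : M = T ⊔ Z := Subgroup.comap_map_eq _ _
  have hTM : T ≤ M := hMT ▸ le_sup_left
  let _ := Fintype.ofFinite (complements Z M)
  rw [finsum_eq_sum_of_fintype] at h1
  -- If `Z ≤ T`, complements are smaller than `M = T` and the right side is `p` minus their number.
  -- It vanishes only for `p` complements, which forces the image of `T` to be `p`-cyclic.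
  by_cases hZT : Z ≤ T
  · have hMT' : M = T := hMT.trans (sup_eq_left.mpr hZT)
    have hM1 : FB.mark M (FB.idem F T) = 1 := by rw [hMT', FB.mark_idem, if_pos rfl]
    rw [hM1] at h1
    have h2 : ∀ S : complements Z M, FB.mark S.1 (FB.idem F T) - 1 = -1 := by
      intro S
      rw [FB.mark_idem, if_neg, zero_sub]
      intro hcl
      have hST : S.1 ≤ T := (le_sup_left.trans S.2.1.le).trans hMT'.le
      have h3 := Subgroup.eq_of_le_of_card_ge hST (card_eq_of_class hcl).ge
      have h4 := S.2.2
      rw [h3, inf_eq_right.mpr hZT] at h4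
      rw [h4, Subgroup.card_bot] at hZp
      exact hp.one_lt.ne hZp
    rw [Finset.sum_congr rfl fun S _ => h2 S, Finset.sum_const, Finset.card_univ, mul_one,
      nsmul_eq_mul, mul_neg, mul_one, eq_comm, ← sub_eq_add_neg, sub_eq_zero, Nat.cast_inj,
      ← Nat.card_eq_fintype_card] at h1
    obtain ⟨S, hS, hcyc⟩ := isPCyclic_of_card_complements hp hZ hZp h1.symm
    refine hT ?_
    have h5 : S.map (prodId K q) = T.map (prodId K q) := by
      rw [← hMT', ← hS.1, Subgroup.map_sup, (Subgroup.map_eq_bot_iff Z).mpr le_rfl, sup_bot_eq]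
    rw [← h5]
    exact hcyc.map _
  -- If `Z` is not contained in `T`, then `T` is itself a complement of `Z` in `M`, and the right
  -- side is the positive number of complements conjugate to `T`.
  · have hcl : subgroupClass M ≠ subgroupClass T := by
      intro hcl
      have h3 := Subgroup.eq_of_le_of_card_ge hTM (card_eq_of_class hcl).le
      exact hZT (h3 ▸ Subgroup.ker_le_comap _ _)
    have hTc : T ∈ complements Z M := by
      refine ⟨hMT.symm, ?_⟩
      have := Fact.mk hp
      have := Fact.mk (hZp ▸ hp : (Nat.card Z).Prime)
      rcases (T.subgroupOf Z).eq_bot_or_eq_top_of_prime_card with h4 | h4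
      · rw [← Subgroup.subgroupOf_map_subtype, h4, Subgroup.map_bot]
      · exact (hZT (Subgroup.subgroupOf_eq_top.mp h4)).elim
    rw [FB.mark_idem, if_neg hcl, mul_zero, zero_add] at h1
    simp only [FB.mark_idem, sub_zero] at h1
    rw [Finset.sum_boole, eq_comm, Nat.cast_eq_zero, Finset.card_eq_zero] at h1
    have h4 : (⟨T, hTc⟩ : complements Z M) ∈ (Finset.univ.filter fun S : complements Z M =>
      subgroupClass S.1 = subgroupClass T) := by simp
    rw [h1] at h4
    simp at h4

/-- Induction on `|G|`, factoring `f` through a central subgroup of order `p` of its kernel. The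
intermediate image is not `p`-cyclic because its own image is not. -/
theorem Supp.push (hp : p.Prime) (hH : IsPGroup p H) (n : ℕ) :
    ∀ {G : Type u} [Group G] [Finite G] {hG : IsPGroup p G} {f : G →* H}, Nat.card G = n →
      Function.Surjective f → ∀ {T : Subgroup (G × K)}, I.Supp hG T →
      ¬ IsPCyclic p (T.map (prodId K f)) → I.Supp hH (T.map (prodId K f)) := by
  induction n using Nat.strong_induction_on with
  | _ n ih =>
    intro G _ _ hG f hn hf T h hT
    have := Fact.mk hp
    by_cases hker : f.ker = ⊥
    · let e : G ≃* H := MulEquiv.ofBijective f ⟨(MonoidHom.ker_eq_bot_iff f).mp hker, hf⟩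
      refine Supp.pull (hG := hG) e.symm.toMonoidHom ?_
      rw [Subgroup.map_map]
      have h1 : (prodId K e.symm.toMonoidHom).comp (prodId K f) = MonoidHom.id _ := by
        ext ⟨g, k⟩
        · exact e.symm_apply_apply g
        · rfl
      rwa [h1, Subgroup.map_id]
    · obtain ⟨z, hzf, hzc, hz⟩ : ∃ z : G, z ∈ f.ker ∧ z ∈ Subgroup.center G ∧ orderOf z = p := by
        have h1 : p ∣ Nat.card f.ker := (hG.to_subgroup f.ker).card_eq_or_dvd.resolve_left
          (fun h => hker (Subgroup.card_eq_one.mp h))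
        have hconj : IsPGroup p (ConjAct G) := hG.of_equiv ConjAct.toConjAct
        -- A nontrivial normal subgroup of a `p`-group meets the center: conjugation fixes `1`,
        -- hence a further element.
        obtain ⟨b, hb, hb1⟩ := hconj.exists_fixed_point_of_prime_dvd_card_of_fixed_point f.ker h1
          (a := 1) (fun g => smul_one g)
        have hbc : b.1 ∈ Subgroup.center G := Subgroup.mem_center_iff.mpr fun g => by
          have h2 : g * b.1 * g⁻¹ = b.1 := congrArg Subtype.val (hb (ConjAct.toConjAct g))
          exact mul_inv_eq_iff_eq_mul.mp h2
        have h3 : p ∣ Nat.card (f.ker ⊓ Subgroup.center G : Subgroup G) :=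
          (hG.to_subgroup _).card_eq_or_dvd.resolve_left fun h => hb1 (by
            have h4 : b.1 ∈ (f.ker ⊓ Subgroup.center G : Subgroup G) :=
              Subgroup.mem_inf.mpr ⟨b.2, hbc⟩
            rw [Subgroup.card_eq_one.mp h, Subgroup.mem_bot] at h4
            exact Subtype.ext h4.symm)
        obtain ⟨z, hz⟩ := exists_prime_orderOf_dvd_card' p h3
        exact ⟨z.1, z.2.1, z.2.2, by rw [Subgroup.orderOf_coe, hz]⟩
      have hnorm : (Subgroup.zpowers z).Normal := ⟨fun a ha g => by
        have : a ∈ Subgroup.center G := (Subgroup.zpowers_le.mpr hzc) ha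
        rwa [Subgroup.mem_center_iff.mp this g, mul_inv_cancel_right]⟩
      let q := QuotientGroup.mk' (Subgroup.zpowers z)
      let f' : G ⧸ Subgroup.zpowers z →* H :=
        QuotientGroup.lift _ f (Subgroup.zpowers_le.mpr hzf)
      have hff : (prodId K f').comp (prodId K q) = prodId K f := rfl
      have hkerq : (prodId K q).ker = Subgroup.zpowers ((z, 1) : G × K) := by
        ext ⟨g, k⟩
        rw [MonoidHom.mem_ker, Subgroup.mem_zpowers_iff]
        constructor
        · intro h1
          have h2 : g ∈ Subgroup.zpowers z :=
            (QuotientGroup.eq_one_iff g).mp (congrArg Prod.fst h1)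
          obtain ⟨j, rfl⟩ := h2
          obtain rfl : k = 1 := congrArg Prod.snd h1
          exact ⟨j, by simp⟩
        · rintro ⟨j, h1⟩
          rw [Prod.pow_mk, one_zpow] at h1
          obtain ⟨rfl, rfl⟩ := Prod.ext_iff.mp h1
          exact Prod.ext ((QuotientGroup.eq_one_iff _).mpr ⟨j, rfl⟩) rfl
      have hcz : (prodId K q).ker ≤ Subgroup.center (G × K) := by
        rw [hkerq, Subgroup.zpowers_le, Subgroup.mem_center_iff]
        rintro ⟨g, k⟩
        rw [Prod.mk_mul_mk, Prod.mk_mul_mk, Subgroup.mem_center_iff.mp hzc g, mul_one, one_mul]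
      have hcard : Nat.card (prodId K q).ker = p := by
        rw [hkerq, Nat.card_zpowers, Prod.orderOf_mk, orderOf_one, Nat.lcm_one_right, hz]
      rw [← hff, ← Subgroup.map_map] at hT ⊢
      have hlt : Nat.card (G ⧸ Subgroup.zpowers z) < n := by
        rw [← hn, Subgroup.card_eq_card_quotient_mul_card_subgroup (Subgroup.zpowers z),
          Nat.card_zpowers, hz]
        exact lt_mul_of_one_lt_right Nat.card_pos hp.one_lt
      refine ih _ hlt (hG := hG.to_quotient _) rfl
        (QuotientGroup.lift_surjective_of_surjective _ _ hf _) ?_ hT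
      exact h.push_central hp (QuotientGroup.mk'_surjective _) hcz hcard
        (fun h1 => hT (h1.map _))

theorem Supp.of_not_isPCyclic (hp : p.Prime) {L : Subgroup (G × K)} (h : I.Supp hG L)
    {M : Subgroup (H × K)} (hM : sndClass M = sndClass L) (hMp : ¬ IsPCyclic p M) :
    I.Supp hH M := by
  obtain ⟨k, hk⟩ := subgroupClass_eq_iff.mp hM
  -- Conjugating by an element of `K` makes the two projections equal, as the fibre product
  -- requires.
  set L' := ConjAct.toConjAct ((1 : G), ConjAct.ofConjAct k) • L with hL'
  have hL'' : L'.map (MonoidHom.snd G K) = M.map (MonoidHom.snd H K) := by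
    rw [← hk]
    ext b
    simp only [hL', Subgroup.mem_smul_pointwise_iff_exists, Subgroup.mem_map, ConjAct.smul_def,
      ConjAct.ofConjAct_toConjAct]
    constructor
    · rintro ⟨_, ⟨a, ha, rfl⟩, rfl⟩
      exact ⟨_, ⟨a, ha, rfl⟩, rfl⟩
    · rintro ⟨_, ⟨a, ha, rfl⟩, rfl⟩
      exact ⟨_, ⟨a, ha, rfl⟩, rfl⟩
  have h1 : I.Supp hG L' := h.of_class (subgroupClass_smul _ _).symm
  -- The fibre product of `M` and `L'` over `K`; it maps onto both since their projections agree.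
  set T : Subgroup ((H × G) × K) := M.comap (prodId K (MonoidHom.fst H G)) ⊓
    L'.comap (prodId K (MonoidHom.snd H G)) with hT
  have hTL : T.map (prodId K (MonoidHom.snd H G)) = L' := by
    refine le_antisymm (Subgroup.map_le_iff_le_comap.mpr inf_le_right) ?_
    rintro ⟨g, c⟩ hg
    have h2 : c ∈ M.map (MonoidHom.snd H K) := hL'' ▸ ⟨_, hg, rfl⟩
    obtain ⟨⟨x, c'⟩, hx, rfl⟩ := h2
    exact ⟨((x, g), c'), ⟨hx, hg⟩, rfl⟩
  have hTM : T.map (prodId K (MonoidHom.fst H G)) = M := by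
    refine le_antisymm (Subgroup.map_le_iff_le_comap.mpr inf_le_left) ?_
    rintro ⟨x, c⟩ hx
    have h2 : c ∈ L'.map (MonoidHom.snd G K) := hL'' ▸ ⟨_, hx, rfl⟩
    obtain ⟨⟨g, c'⟩, hg, rfl⟩ := h2
    exact ⟨((x, g), c'), ⟨hx, hg⟩, rfl⟩
  have h2 : I.Supp (isPGroup_prod hH hG) T := Supp.pull (MonoidHom.snd H G) (hTL.symm ▸ h1)
  rw [← hTM] at hMp ⊢
  exact Supp.push hp hH _ rfl Prod.fst_surjective h2 hMp

end GreenIdeal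

/-! ## The classification of ideals -/

theorem sndClass_map {G H K : Type u} [Group G] [Group H] [Group K] (T : Subgroup (H × K))
    (f : H →* G) : sndClass (T.map (prodId K f)) = sndClass T := by
  rw [sndClass, Subgroup.map_map]
  rfl

theorem sndClass_of_class {G K : Type u} [Group G] [Group K] {L M : Subgroup (G × K)}
    (h : subgroupClass L = subgroupClass M) : sndClass L = sndClass M :=
  subgroupClass_map h _

theorem sndClass_top_prod {G K : Type u} [Group G] [Group K] (S : Subgroup K) :
    sndClass ((⊤ : Subgroup G).prod S) = subgroupClass S := by
  rw [sndClass]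
  congr 1
  ext k
  constructor
  · rintro ⟨x, hx, rfl⟩
    exact hx.2
  · exact fun hk => ⟨(1, k), ⟨trivial, hk⟩, rfl⟩

/-! ### An elementary abelian group of rank two -/

/-- A noncyclic `p`-group of order `p ^ 2`. -/
abbrev ElemAb (p : ℕ) : Type u := Multiplicative (ULift.{u} (ZMod p × ZMod p))

theorem ElemAb.pow_eq_one {p : ℕ} (x : ElemAb.{u} p) : x ^ p = 1 := by
  apply Multiplicative.toAdd.injective
  rw [toAdd_pow, toAdd_one]
  apply ULift.down_injective
  exact Prod.ext (by simp) (by simp)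

theorem ElemAb.isPGroup {p : ℕ} : IsPGroup p (ElemAb.{u} p) :=
  fun x => ⟨1, by rw [pow_one, ElemAb.pow_eq_one]⟩

theorem ElemAb.card {p : ℕ} : Nat.card (ElemAb.{u} p) = p * p := by
  rw [Nat.card_congr (Multiplicative.toAdd.trans Equiv.ulift), Nat.card_prod, Nat.card_zmod]

theorem ElemAb.not_isPCyclic {p : ℕ} (hp : p.Prime) : ¬ IsPCyclic p (ElemAb.{u} p) := by
  intro h
  obtain ⟨a, ha⟩ := isPCyclic_iff.mp h
  have := Fact.mk hp
  have h1 : Subgroup.zpowers a = ⊤ := by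
    rw [eq_top_iff, ← ha, Subgroup.closure_le]
    rintro y (hy | rfl)
    · obtain rfl : y = 1 := by
        by_contra hne
        exact hy (ElemAb.isPGroup.dvd_orderOf hne)
      exact one_mem _
    · exact Subgroup.mem_zpowers _
  have h2 : orderOf a = p * p := by
    rw [← Nat.card_zpowers, h1, Subgroup.card_top, ElemAb.card]
  have h3 := Nat.le_of_dvd hp.pos (h2 ▸ orderOf_dvd_of_pow_eq_one (ElemAb.pow_eq_one a))
  exact absurd h3 (not_le.mpr (lt_mul_of_one_lt_right hp.pos hp.one_lt))

namespace GreenIdeal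

variable {p : ℕ} {K : Type u} [Group K] [Finite K]

/-- The ideal of elements whose marks are supported on subgroups lying over `B`, and over `A` for
subgroups with cyclic largest `p`-quotient. -/
def ofClasses [CharZero F] (hp : p.Prime) (A B : Set (SubgroupClass K)) :
    GreenIdeal F p K where
  carrier G _ _ _ :=
    { carrier := {x | ∀ L : Subgroup (G × K), FB.mark L x ≠ 0 →
        sndClass L ∈ B ∧ (IsPCyclic p L → sndClass L ∈ A)}
      zero_mem' := fun L h => (h (map_zero _)).elim
      add_mem' := fun {x y} hx hy L h => by
        by_cases hxL : FB.mark L x = 0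
        · refine hy L fun hyL => h ?_
          rw [map_add, hxL, hyL, add_zero]
        · exact hx L hxL
      smul_mem' := fun r x hx L h => hx L fun hxL => h (by rw [map_smul, hxL, smul_zero]) }
  map_mem G H _ _ _ _ hG hH U x hx L hL := by
    refine ⟨?_, fun hcyc => ?_⟩
    · by_contra hB
      -- If the class of the projection of `L` is not in `B`, the idempotent of that projection
      -- annihilates `x`. By the Frobenius relation it annihilates the image of `x`, whose mark at
      -- `L` is then zero.
      have h0 : FB.mul x (FB.comap (MonoidHom.snd G K)
          (FB.idem F (L.map (MonoidHom.snd H K)))) = 0 := by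
        refine FB.ext_mark fun M => ?_
        rw [FB.mark_mul, FB.mark_comap, FB.mark_idem, map_zero]
        by_cases hM : FB.mark M x = 0
        · rw [hM, zero_mul]
        · rw [if_neg, mul_zero]
          intro hML
          refine hB ?_
          have hML : sndClass M = sndClass L := hML
          exact hML ▸ (hx M hM).1
      have h1 := congrArg (FB.mark L) (U.frobenius x (FB.idem F (L.map (MonoidHom.snd H K))))
      rw [h0, map_zero, map_zero, FB.mark_mul, FB.mark_comap, FB.mark_idem, if_pos rfl,
        mul_one] at h1
      exact hL h1.symm
    · obtain ⟨N, h, k, hN, rfl⟩ := hcyc.exists_eq_cyclicOver hp hH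
      let _ := Fintype.ofFinite G
      have h1 := U.mark_cyclicOver hp hG x hN h k
      have h2 : (Nat.card G : F) * FB.mark (cyclicOver N h k) ((U.shift K).map F x) ≠ 0 :=
        mul_ne_zero (Nat.cast_ne_zero.mpr Nat.card_pos.ne') hL
      rw [h1] at h2
      -- A nonzero mark of the image comes from a nonzero mark of `x` at a `p`-cyclic subgroup with
      -- the same projection.
      obtain ⟨g, -, hg⟩ := Finset.exists_ne_zero_of_sum_ne_zero h2
      have h3 := (hx _ (right_ne_zero_of_mul hg)).2 (isPCyclic_cyclicOver hN g k)
      rw [sndClass, map_snd_cyclicOver] at h3 ⊢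
      exact h3
  prod_mem_left G H _ _ _ _ hG hH a b hb T hT := by
    rw [mark_shiftProd] at hT
    have h := hb _ (right_ne_zero_of_mul hT)
    rw [sndClass_map] at h
    exact ⟨h.1, fun hc => h.2 (hc.map _)⟩
  prod_mem_right G H _ _ _ _ hG hH a b ha T hT := by
    rw [mark_shiftProd] at hT
    have h := ha _ (left_ne_zero_of_mul hT)
    rw [sndClass_map] at h
    exact ⟨h.1, fun hc => h.2 (hc.map _)⟩

/-! ### The two sets of classes attached to an ideal -/

/-- The classes over which some subgroup is in the support of the ideal. -/
def classes (I : GreenIdeal F p K) : Set (SubgroupClass K) :=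
  {c | ∃ (G : Type u) (_ : Group G) (_ : Finite G) (hG : IsPGroup p G) (L : Subgroup (G × K)),
    sndClass L = c ∧ I.Supp hG L}

/-- The classes over which some subgroup with cyclic largest `p`-quotient is in the support of
the ideal. -/
def cycClasses (I : GreenIdeal F p K) : Set (SubgroupClass K) :=
  {c | ∃ (G : Type u) (_ : Group G) (_ : Finite G) (hG : IsPGroup p G) (L : Subgroup (G × K)),
    sndClass L = c ∧ I.Supp hG L ∧ IsPCyclic p L}

theorem cycClasses_subset (I : GreenIdeal F p K) : I.cycClasses ⊆ I.classes :=
  fun _ ⟨G, i, j, hG, L, h⟩ => ⟨G, i, j, hG, L, h.1, h.2.1⟩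

theorem exists_of_mem_cycClasses {I : GreenIdeal F p K} {c : SubgroupClass K}
    (h : c ∈ I.cycClasses) : ∃ S : Subgroup K, subgroupClass S = c ∧ IsPCyclic p S := by
  obtain ⟨G, _, _, hG, L, rfl, -, hL⟩ := h
  exact ⟨_, rfl, hL.map _⟩

open Classical in
/-- The level of an ideal at a class with cyclic largest `p`-quotient. -/
def level (I : GreenIdeal F p K) (c : SubgroupClass K) : Fin 3 :=
  if c ∈ I.cycClasses then 2 else if c ∈ I.classes then 1 else 0

open Classical in
/-- The level of an ideal at a class with noncyclic largest `p`-quotient. -/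
def noncycLevel (I : GreenIdeal F p K) (c : SubgroupClass K) : Fin 2 :=
  if c ∈ I.classes then 1 else 0

theorem level_le_iff {I J : GreenIdeal F p K} {c : SubgroupClass K} :
    I.level c ≤ J.level c ↔
      (c ∈ I.cycClasses → c ∈ J.cycClasses) ∧ (c ∈ I.classes → c ∈ J.classes) := by
  have hI := @cycClasses_subset _ _ _ _ _ _ I c
  have hJ := @cycClasses_subset _ _ _ _ _ _ J c
  unfold level
  split_ifs <;> simp_all

theorem noncycLevel_le_iff {I J : GreenIdeal F p K} {c : SubgroupClass K} :
    I.noncycLevel c ≤ J.noncycLevel c ↔ (c ∈ I.classes → c ∈ J.classes) := by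
  unfold noncycLevel
  split_ifs <;> simp_all

variable [CharZero F]

/-- The two transfer results cover the `p`-cyclic and the remaining subgroups, so the two sets of
classes determine the whole support. -/
theorem le_iff (hp : p.Prime) {I J : GreenIdeal F p K} :
    I ≤ J ↔ I.cycClasses ⊆ J.cycClasses ∧ I.classes ⊆ J.classes := by
  constructor
  · intro h
    constructor
    · rintro c ⟨G, _, _, hG, L, hc, ⟨x, hx, hne⟩, hL⟩
      exact ⟨G, _, _, hG, L, hc, ⟨x, h G hG hx, hne⟩, hL⟩
    · rintro c ⟨G, _, _, hG, L, hc, ⟨x, hx, hne⟩⟩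
      exact ⟨G, _, _, hG, L, hc, ⟨x, h G hG hx, hne⟩⟩
  · rintro ⟨hA, hB⟩ G _ _ hG x hx
    rw [mem_iff] at hx ⊢
    intro L hL
    by_cases hcyc : IsPCyclic p L
    · obtain ⟨H, _, _, hH, M, hc, hM, hMc⟩ := hA ⟨G, _, _, hG, L, rfl, hx L hL, hcyc⟩
      exact hM.of_isPCyclic hp hMc hc.symm
    · obtain ⟨H, _, _, hH, M, hc, hM⟩ := hB ⟨G, _, _, hG, L, rfl, hx L hL⟩
      exact hM.of_not_isPCyclic hp hc.symm hcyc

theorem classes_ofClasses (hp : p.Prime) (A B : Set (SubgroupClass K)) :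
    (ofClasses (F := F) hp A B).classes = B := by
  classical
  have := Fact.mk hp
  apply Set.Subset.antisymm
  · rintro c ⟨G, _, _, hG, L, rfl, x, hx, hne⟩
    exact (hx L hne).1
  · intro c hc
    rw [← subgroupClass_out c] at hc ⊢
    -- Over any class there is a subgroup that is not `p`-cyclic: the product with `ElemAb p`, which
    -- has `ElemAb p` as a quotient. The condition on `A` is void there.
    refine ⟨ElemAb p, _, inferInstance, ElemAb.isPGroup, (⊤ : Subgroup _).prod c.out,
      sndClass_top_prod _, supp_iff.mpr fun M hM => ?_⟩
    rw [FB.mark_idem, ite_ne_right_iff] at hM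
    refine ⟨?_, fun hcyc => ?_⟩
    · rwa [sndClass_of_class hM.1, sndClass_top_prod]
    · refine (ElemAb.not_isPCyclic hp ?_).elim
      refine (((isPCyclic_of_class hM.1).mp hcyc).of_surjective
        ((MonoidHom.fst (ElemAb p) K).comp (Subgroup.subtype _)) fun a => ?_)
      exact ⟨⟨(a, 1), ⟨trivial, one_mem _⟩⟩, rfl⟩

/-- Projections of `p`-cyclic subgroups are `p`-cyclic, so other classes in `A` have no effect; a
`p`-cyclic `S` is realized over the trivial group. -/
theorem cycClasses_ofClasses (hp : p.Prime) {A B : Set (SubgroupClass K)} (hAB : A ⊆ B) :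
    (ofClasses (F := F) hp A B).cycClasses =
      {c | c ∈ A ∧ ∃ S : Subgroup K, subgroupClass S = c ∧ IsPCyclic p S} := by
  classical
  apply Set.Subset.antisymm
  · rintro c h
    refine ⟨?_, exists_of_mem_cycClasses h⟩
    obtain ⟨G, _, _, hG, L, rfl, ⟨x, hx, hne⟩, hL⟩ := h
    exact (hx L hne).2 hL
  · rintro _ ⟨hc, S, rfl, hS⟩
    refine ⟨PUnit, _, inferInstance, IsPGroup.of_subsingleton _ _, (⊤ : Subgroup _).prod S,
      sndClass_top_prod _, supp_iff.mpr fun M hM => ?_, ?_⟩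
    · rw [FB.mark_idem, ite_ne_right_iff] at hM
      rw [sndClass_of_class hM.1, sndClass_top_prod]
      exact ⟨hAB hc, fun _ => hc⟩
    · exact hS.of_surjective (((MonoidHom.inr PUnit K).comp S.subtype).codRestrict _
        fun s => ⟨trivial, s.2⟩) fun x => ⟨⟨x.1.2, x.2.2⟩, rfl⟩

/-- The lattice of ideals is a product of chains. -/
theorem nonempty_orderIso (hp : p.Prime) : Nonempty (GreenIdeal F p K ≃o
    (Fin (cycCount p K) → Fin 3) × (Fin (noncycCount p K) → Fin 2)) := by
  classical
  let e₁ := Finite.equivFin {C : SubgroupClass K //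
    ∃ H : Subgroup K, Quotient.mk _ H = C ∧ IsCyclic (H ⧸ pResidual p H)}
  let e₂ := Finite.equivFin {C : SubgroupClass K //
    ∃ H : Subgroup K, Quotient.mk _ H = C ∧ ¬ IsCyclic (H ⧸ pResidual p H)}
  let Φ : GreenIdeal F p K → (Fin (cycCount p K) → Fin 3) × (Fin (noncycCount p K) → Fin 2) :=
    fun I => (fun i => I.level (e₁.symm i).1, fun j => I.noncycLevel (e₂.symm j).1)
  have hΦ : ∀ I J, Φ I ≤ Φ J ↔ I ≤ J := by
    intro I J
    rw [le_iff hp]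
    constructor
    · rintro ⟨h₁, h₂⟩
      have h₁' : ∀ c, (∃ S : Subgroup K, subgroupClass S = c ∧ IsPCyclic p S) →
          I.level c ≤ J.level c := fun c hc => by
        have := h₁ (e₁ ⟨c, hc⟩)
        simpa [Φ] using this
      have h₂' : ∀ c, (∃ S : Subgroup K, subgroupClass S = c ∧ ¬ IsPCyclic p S) →
          I.noncycLevel c ≤ J.noncycLevel c := fun c hc => by
        have := h₂ (e₂ ⟨c, hc⟩)
        simpa [Φ] using this
      refine ⟨fun c hc => (level_le_iff.mp (h₁' c (exists_of_mem_cycClasses hc))).1 hc,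
        fun c hc => ?_⟩
      by_cases hcyc : IsPCyclic p c.out
      · exact (level_le_iff.mp (h₁' c ⟨_, subgroupClass_out c, hcyc⟩)).2 hc
      · exact noncycLevel_le_iff.mp (h₂' c ⟨_, subgroupClass_out c, hcyc⟩) hc
    · rintro ⟨h₁, h₂⟩
      exact ⟨fun i => level_le_iff.mpr ⟨fun h => h₁ h, fun h => h₂ h⟩,
        fun j => noncycLevel_le_iff.mpr fun h => h₂ h⟩
  have hsurj : Function.Surjective Φ := by
    rintro ⟨f, g⟩
    -- Level `2` means membership in `A`, and any nonzero level membership in `B`, so `A ⊆ B`.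
    let A : Set (SubgroupClass K) := {c | ∃ h, f (e₁ ⟨c, h⟩) = 2}
    let B : Set (SubgroupClass K) := {c | (∃ h, f (e₁ ⟨c, h⟩) ≠ 0) ∨ ∃ h, g (e₂ ⟨c, h⟩) = 1}
    have hAB : A ⊆ B := fun c ⟨h, hc⟩ => Or.inl ⟨h, by rw [hc]; decide⟩
    -- Being `p`-cyclic is invariant under conjugation, so no class is counted in both factors.
    have hdisj : ∀ c : SubgroupClass K,
        (∃ S : Subgroup K, Quotient.mk _ S = c ∧ IsCyclic (S ⧸ pResidual p S)) →
        ¬ ∃ S : Subgroup K, Quotient.mk _ S = c ∧ ¬ IsCyclic (S ⧸ pResidual p S) := by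
      rintro c ⟨S, rfl, hS⟩ ⟨T, hT, hT'⟩
      exact hT' ((isPCyclic_of_class (p := p) hT).mpr hS)
    refine ⟨ofClasses hp A B, Prod.ext (funext fun i => ?_) (funext fun j => ?_)⟩
    · obtain ⟨⟨c, hc⟩, rfl⟩ := e₁.surjective i
      have h1 : c ∈ (ofClasses (F := F) hp A B).cycClasses ↔ f (e₁ ⟨c, hc⟩) = 2 := by
        rw [cycClasses_ofClasses hp hAB]
        exact ⟨fun h => h.1.2, fun h => ⟨⟨hc, h⟩, hc⟩⟩
      have h2 : c ∈ (ofClasses (F := F) hp A B).classes ↔ f (e₁ ⟨c, hc⟩) ≠ 0 := by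
        rw [classes_ofClasses hp]
        exact ⟨fun h => h.elim (fun h => h.2) fun h => (hdisj c hc h.1).elim,
          fun h => Or.inl ⟨hc, h⟩⟩
      show (ofClasses hp A B).level (e₁.symm (e₁ ⟨c, hc⟩)).1 = f (e₁ ⟨c, hc⟩)
      rw [Equiv.symm_apply_apply, level]
      simp only [h1, h2]
      generalize f (e₁ ⟨c, hc⟩) = t
      revert t
      decide
    · obtain ⟨⟨c, hc⟩, rfl⟩ := e₂.surjective j
      have h2 : c ∈ (ofClasses (F := F) hp A B).classes ↔ g (e₂ ⟨c, hc⟩) = 1 := by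
        rw [classes_ofClasses hp]
        exact ⟨fun h => h.elim (fun h => (hdisj c h.1 hc).elim) fun h => h.2,
          fun h => Or.inr ⟨hc, h⟩⟩
      show (ofClasses hp A B).noncycLevel (e₂.symm (e₂ ⟨c, hc⟩)).1 = g (e₂ ⟨c, hc⟩)
      rw [Equiv.symm_apply_apply, noncycLevel]
      simp only [h2]
      generalize g (e₂ ⟨c, hc⟩) = t
      revert t
      decide
  have hinj : Function.Injective Φ := fun I J h =>
    le_antisymm ((hΦ I J).mp h.le) ((hΦ J I).mp h.ge)
  exact ⟨⟨Equiv.ofBijective Φ ⟨hinj, hsurj⟩, hΦ _ _⟩⟩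

end GreenIdeal

end RelativeBGroups

end

theorem mainTheorem10 {F : Type*} [Field F] [CharZero F] {p : ℕ} (hp : p.Prime)
    (K : Type*) [Group K] [Finite K] :
    Nonempty (RelativeBGroups.GreenIdeal F p K ≃o
      (Fin (RelativeBGroups.cycCount p K) → Fin 3) ×
        (Fin (RelativeBGroups.noncycCount p K) → Fin 2)) ∧
    Finite (RelativeBGroups.GreenIdeal F p K) ∧
    ∀ I J L : RelativeBGroups.GreenIdeal F p K, I ⊓ (J ⊔ L) = (I ⊓ J) ⊔ (I ⊓ L) := by
  obtain ⟨e⟩ := RelativeBGroups.GreenIdeal.nonempty_orderIso (F := F) (K := K) hp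
  refine ⟨⟨e⟩, Finite.of_equiv _ e.symm.toEquiv, fun I J L => e.injective ?_⟩
  rw [e.map_inf, e.map_sup, e.map_sup, e.map_inf, e.map_inf, inf_sup_left]
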